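/- Let $\operatorname{Arm}_3(n)$ be the space of $n$-edge polygons (closed or not) of total length $2$ in $\mathbb{R}^3$ up to translation, i.e. of edge lists $(e_1,\dots,e_n)$ in $\mathbb{R}^3$ with $\sum_i|e_i|=2$. Let $\operatorname{Arm}_2(n)\subset\operatorname{Arm}_3(n)$ be the subspace of polygons lying in a fixed plane (below: the $\mathbf{i}$-$\mathbf{k}$ plane), and let $\operatorname{Pol}_i(n)\subset\operatorname{Arm}_i(n)$ be the subspace of closed polygons, those with $\sum_i e_i=0$. Identify $\mathbb{R}^3$ with the imaginary quaternions, let $\operatorname{Hopf}(q)=\bar q\,\mathbf{i}\,q$, and let $\operatorname{Hopf}$ act coordinatewise on $\mathbb{H}^n=\mathbb{C}^n\oplus\mathbb{C}^n\mathbf{j}$. Consider the following compact submanifolds of $\mathbb{H}^n$: * the sphere $S^{4n-1}\subset\mathbb{H}^n$ of radius $\sqrt2$; * the disjoint union $S^{2n-1}\sqcup S^{2n-1}$ of the spheres of radius $\sqrt 2$ in $(1\oplus\mathbf{j})^n$ and $(\mathbf{i}\oplus\mathbf{k})^n$; * the Stiefel manifold $V_2(\mathbb{C}^n)$ of Hermitian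 orthonormal $2$-frames $(u,v)$ in $\mathbb{C}^n$, embedded as the points $u+v\mathbf{j}$; * the disjoint union $V_2(\mathbb{R}^n)\sqcup\mathbf{i}V_2(\mathbb{R}^n)$, where $V_2(\mathbb{R}^n)\subset V_2(\mathbb{C}^n)$ is the manifold of real orthonormal $2$-frames. The map $\operatorname{Hopf}$ takes them to $\operatorname{Arm}_3(n)$, $\operatorname{Arm}_2(n)$, $\operatorname{Pol}_3(n)$ and $\operatorname{Pol}_2(n)$ respectively. The symmetric measure on each of these polygon spaces is the pushforward under $\operatorname{Hopf}$ of the Riemannian volume (for the metric induced from $\mathbb{H}^n$) of the corresponding manifold, normalized to total mass $1$. For a polygon with vertices $v_1,\dots,v_m$ let $$\operatorname{Gyradius}=\frac{1}{2m^2}\sum_{i,j=1}^m|v_i-v_j|^2 .$$ A polygon in $\operatorname{Arm}_i(n)$ is regarded as having $m=n+1$ vertices, and one in $\operatorname{Pol}_i(n)$ as having $m=n$ vertices, because its last vertex coincides with its first. The expected values of $\operatorname{Gyradius}$ with respect to the symmetric measures are, for $n\ge1$, $$E(\operatorname{Gyradius},\operatorname{Arm}_3(n))=\frac{n+2}{(n+1)(n+\frac12)},\qquad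 E(\operatorname{Gyradius},\operatorname{Arm}_2(n))=\frac43\,\frac{n+2}{(n+1)^2},$$ and, for $n\ge2$, $$E(\operatorname{Gyradius},\operatorname{Pol}_3(n))=\frac12\,\frac1n,\qquad E(\operatorname{Gyradius},\operatorname{Pol}_2(n))=\frac23\,\frac{n+1}{n(n+2)} .$$ -/

import Mathlib

open MeasureTheory

noncomputable section

namespace RandomPolygon

/-! ### Polygons and their radius of gyration -/

/-- Edge lists `(e₁, …, eₙ)` of `n`-edge polygons in `ℝ³`, i.e. polygons up to translation. -/
abbrev EdgeList (n : ℕ) : Type := Fin n → EuclideanSpace ℝ (Fin 3)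

/-- Space arms: `n`-edge polygons in `ℝ³`, closed or not, of total length `2`. -/
def Arm3 (n : ℕ) : Set (EdgeList n) := {e | ∑ i, ‖e i‖ = 2}

/-- Plane arms. `ℝ³` is identified with the imaginary quaternions, with coordinates `0, 1, 2` along
`𝐢, 𝐣, 𝐤`; the fixed plane is the `𝐢`-`𝐤` plane, the one onto which the Hopf map takes the planar
model spaces below. -/
def Arm2 (n : ℕ) : Set (EdgeList n) := {e | e ∈ Arm3 n ∧ ∀ i, e i 1 = 0}

/-- Closed space polygons. -/
def Pol3 (n : ℕ) : Set (EdgeList n) := {e | e ∈ Arm3 n ∧ ∑ i, e i = 0}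

/-- Closed plane polygons. -/
def Pol2 (n : ℕ) : Set (EdgeList n) := {e | e ∈ Arm2 n ∧ ∑ i, e i = 0}

/-- The vertex reached from the origin after the first `k` edges. -/
def vertex {n : ℕ} (e : EdgeList n) (k : ℕ) : EuclideanSpace ℝ (Fin 3) :=
  ∑ j ∈ Finset.univ.filter (fun j : Fin n => (j : ℕ) < k), e j

/-- (Squared) radius of gyration of a list of `m` vertices: half of the average squared distance
between two vertices, repeated pairs included. -/
def vertexGyradius {m : ℕ} (v : Fin m → EuclideanSpace ℝ (Fin 3)) : ℝ :=
  1 / (2 * (m : ℝ) ^ 2) * ∑ i, ∑ j, ‖v i - v j‖ ^ 2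

/-- An arm with `n` edges has the `n + 1` vertices `v₁, …, vₙ₊₁`. -/
def armGyradius {n : ℕ} (e : EdgeList n) : ℝ :=
  vertexGyradius (fun k : Fin (n + 1) => vertex e k)

/-- A closed polygon with `n` edges has the `n` vertices `v₁, …, vₙ` (the last vertex of the arm
is the first one again). -/
def polGyradius {n : ℕ} (e : EdgeList n) : ℝ :=
  vertexGyradius (fun k : Fin n => vertex e k)

/-! ### Quaternionic `n`-space and the Hopf map -/

instance : MeasurableSpace (Quaternion ℝ) := borel _

instance : BorelSpace (Quaternion ℝ) := ⟨rfl⟩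

instance : SecondCountableTopology (Quaternion ℝ) :=
  Quaternion.linearIsometryEquivTuple.toHomeomorph.secondCountableTopology

/-- `ℍⁿ` with its Euclidean metric (that of `ℝ⁴ⁿ`). -/
abbrev QuaternionSpace (n : ℕ) : Type := EuclideanSpace (Quaternion ℝ) (Fin n)

def quatI : Quaternion ℝ := ⟨0, 1, 0, 0⟩

def quatJ : Quaternion ℝ := ⟨0, 0, 1, 0⟩

/-- The Hopf map `q ↦ q̄ 𝐢 q`, whose values are imaginary quaternions, regarded as vectors of `ℝ³`. -/
def hopf (q : Quaternion ℝ) : EuclideanSpace ℝ (Fin 3) :=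
  !₂[(star q * quatI * q).imI, (star q * quatI * q).imJ, (star q * quatI * q).imK]

/-- The coordinatewise Hopf map. -/
def hopfMap {n : ℕ} (q : QuaternionSpace n) : EdgeList n := fun i => hopf (q i)

/-! ### The model spaces -/

/-- The sphere `S⁴ⁿ⁻¹` of radius `√2` in `ℍⁿ`. -/
def arm3Model (n : ℕ) : Set (QuaternionSpace n) := Metric.sphere 0 (Real.sqrt 2)

/-- The two spheres `S²ⁿ⁻¹ ⊔ S²ⁿ⁻¹` of radius `√2` in `(1 ⊕ 𝐣)ⁿ` and `(𝐢 ⊕ 𝐤)ⁿ`. -/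
def arm2Model (n : ℕ) : Set (QuaternionSpace n) :=
  {q | q ∈ arm3Model n ∧ ∀ i, (q i).imI = 0 ∧ (q i).imK = 0} ∪
  {q | q ∈ arm3Model n ∧ ∀ i, (q i).re = 0 ∧ (q i).imJ = 0}

/-- The Stiefel manifold `V₂(ℂⁿ)` of Hermitian orthonormal 2-frames `(u, v)`, placed in `ℍⁿ` as the
points `u + v𝐣`. -/
def pol3Model (n : ℕ) : Set (QuaternionSpace n) :=
  {q | ∃ u v : EuclideanSpace ℂ (Fin n), ‖u‖ = 1 ∧ ‖v‖ = 1 ∧ inner ℂ u v = 0 ∧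
    ∀ i, q i = Quaternion.coeComplex (u i) + Quaternion.coeComplex (v i) * quatJ}

/-- The disjoint union `V₂(ℝⁿ) ⊔ 𝐢 V₂(ℝⁿ)` in `ℍⁿ`: the points `u + v𝐣` and `𝐢(u + v𝐣)` for
orthonormal 2-frames `(u, v)` in `ℝⁿ`. -/
def pol2Model (n : ℕ) : Set (QuaternionSpace n) :=
  {q | ∃ u v : EuclideanSpace ℝ (Fin n), ‖u‖ = 1 ∧ ‖v‖ = 1 ∧ inner ℝ u v = 0 ∧
    ((∀ i, q i = (u i : Quaternion ℝ) + (v i : Quaternion ℝ) * quatJ) ∨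
     (∀ i, q i = quatI * ((u i : Quaternion ℝ) + (v i : Quaternion ℝ) * quatJ)))}

/-! ### The symmetric measures -/

/-- The normalized volume of a compact `d`-dimensional submanifold `M` of `ℍⁿ`, as a measure on `ℍⁿ`
carried by `M`. The Riemannian volume of the metric induced by `ℍⁿ` is, up to a constant that
cancels, the `d`-dimensional Hausdorff measure `μH[d]`, and
`cond μH[d] M = (μH[d] M)⁻¹ • μH[d].restrict M`. -/
def normalizedVolume {n : ℕ} (d : ℝ) (M : Set (QuaternionSpace n)) :
    Measure (QuaternionSpace n) :=
  ProbabilityTheory.cond (Measure.hausdorffMeasure d) M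

/-- The measure `U ↦ (Vol M)⁻¹ Vol (M ∩ hopfMap⁻¹ U)` on a space `X` of polygons. -/
def pushHopf {n : ℕ} (d : ℝ) (M : Set (QuaternionSpace n)) (X : Set (EdgeList n)) : Measure X :=
  ((normalizedVolume d M).map hopfMap).comap Subtype.val

/-- The symmetric measure on space arms; `dim S⁴ⁿ⁻¹ = 4n - 1`. -/
def symArm3 (n : ℕ) : Measure (Arm3 n) := pushHopf (4 * (n : ℝ) - 1) (arm3Model n) (Arm3 n)

/-- The symmetric measure on plane arms; `dim S²ⁿ⁻¹ = 2n - 1`. -/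
def symArm2 (n : ℕ) : Measure (Arm2 n) := pushHopf (2 * (n : ℝ) - 1) (arm2Model n) (Arm2 n)

/-- The symmetric measure on closed space polygons; `dim V₂(ℂⁿ) = 4n - 4`. -/
def symPol3 (n : ℕ) : Measure (Pol3 n) := pushHopf (4 * (n : ℝ) - 4) (pol3Model n) (Pol3 n)

/-- The symmetric measure on closed plane polygons; `dim V₂(ℝⁿ) = 2n - 3`. -/
def symPol2 (n : ℕ) : Measure (Pol2 n) := pushHopf (2 * (n : ℝ) - 3) (pol2Model n) (Pol2 n)

end RandomPolygon

end

/-! Expanding each squared vertex distance in the edges shows that the expected gyradius depends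
only on the correlations E⟨e_i, e_j⟩. Permutations of the coordinates are isometries of `ℍⁿ`
preserving every model, so these correlations take two values: A = E‖q_a‖⁴ on the diagonal and B off
it. Summing |i - j| and (i - j)² over the m vertices gives (m² - 1)(B/12 + (A - B)/(6m)), see
`integral_vertexGyradius`.

No explicit integration over the models is needed to find A and B; linear relations forced by
symmetry suffice. Put C = E‖q_a‖²‖q_b‖² and D = E⟨q_a, q_b⟩² for a ≠ b. The fixed total length gives
nA + n(n - 1)C = 4 (`fourth_moment_eq`). A 45° rotation mixing two coordinates preserves every
model, because norm and closure are quadratic conditions, and it gives A = C + 2D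
(`integral_norm_pow_four`). The Hopf identity `inner_hopf` gives B = 2(D + E⟨𝐢q_a, q_b⟩²) - C, where
the last expectation is D in space (turn the phase of one coordinate) and 0 in the plane. Finally B
= 0 for arms, since one edge may be reversed, while for closed polygons E|Σ e_i|² = 0 gives nA + n(n
- 1)B = 0.

It remains to know that the normalized volumes are probability measures. The models are compact
regular level sets, or unions of two isometric copies of one, and
`hausdorffMeasure_level_pos_finite` shows by the implicit function theorem that such sets have
finite positive Hausdorff measure. Isometry invariance of Hausdorff measure then supplies all the
symmetries above. -/

open Topology Filter
open scoped NNReal ENNReal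

noncomputable section

namespace RandomPolygon

/-! ### Hausdorff measure of regular level sets -/

section LevelSet

/-- A differentiable map that is quadratic along a line has the linear coefficient as its
directional derivative. -/
theorem fderiv_apply_eq_of_quadratic {E F : Type*} [NormedAddCommGroup E]
    [NormedSpace ℝ E] [NormedAddCommGroup F] [NormedSpace ℝ F] {f : E → F} {a h : E}
    (hf : DifferentiableAt ℝ f a) {v w : F}
    (hq : ∀ t : ℝ, f (a + t • h) = f a + t • v + t ^ 2 • w) : fderiv ℝ f a h = v := by
  have h1 : HasDerivAt (fun t : ℝ => f (a + t • h)) (fderiv ℝ f a h) 0 :=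
    hf.hasFDerivAt.hasLineDerivAt h
  have h2 : HasDerivAt (fun t : ℝ => f a + t • v + t ^ 2 • w) v 0 := by
    have h3 : HasDerivAt (fun t : ℝ => t • v) ((1 : ℝ) • v) 0 :=
      (hasDerivAt_id (0 : ℝ)).smul_const v
    have h4 : HasDerivAt (fun t : ℝ => t ^ 2 • w) _ 0 := (hasDerivAt_pow 2 (0 : ℝ)).smul_const w
    simpa using (h3.const_add (f a)).fun_add h4
  exact h1.unique (by simpa only [hq] using h2)

theorem finrank_ker_of_range_eq_top {E F : Type*} [NormedAddCommGroup E] [NormedSpace ℝ E]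
    [FiniteDimensional ℝ E] [NormedAddCommGroup F] [NormedSpace ℝ F] {f' : E →L[ℝ] F}
    (hf' : (f' : E →ₗ[ℝ] F).range = ⊤) {d : ℕ}
    (hd : d + Module.finrank ℝ F = Module.finrank ℝ E) :
    Module.finrank ℝ (f' : E →ₗ[ℝ] F).ker = d := by
  have h := (f' : E →ₗ[ℝ] F).finrank_range_add_finrank_ker
  rw [hf', finrank_top] at h
  omega

variable {E F : Type*} [NormedAddCommGroup E] [NormedSpace ℝ E] [FiniteDimensional ℝ E]
  [MeasurableSpace E] [BorelSpace E] [NormedAddCommGroup F] [NormedSpace ℝ F]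
  [FiniteDimensional ℝ F]

/-- Near `a` the fiber is covered by the image of a bounded set in the kernel of `f'` under the
implicit function. That function is strictly differentiable, hence Lipschitz near 0, and on the
`d`-dimensional kernel `μH[d]` is a Haar measure, finite on balls. -/
theorem exists_nhds_hausdorffMeasure_fiber_lt_top {f : E → F} {f' : E →L[ℝ] F} {a : E}
    (hf : HasStrictFDerivAt f f' a) (hf' : (f' : E →ₗ[ℝ] F).range = ⊤) {d : ℕ}
    (hd : d + Module.finrank ℝ F = Module.finrank ℝ E) :
    ∃ U ∈ 𝓝 a, Measure.hausdorffMeasure (d : ℝ) (f ⁻¹' {f a} ∩ U) < ∞ := by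
  have hk := finrank_ker_of_range_eq_top hf' hd
  have hE : CompleteSpace E := FiniteDimensional.complete ℝ E
  obtain ⟨K, s, hs, hK⟩ := (hf.to_implicitFunction hf').exists_lipschitzOnWith
  have hΦ : Tendsto (fun x => (hf.implicitToOpenPartialHomeomorph f f' hf' x).2) (𝓝 a)
      (𝓝 0) := by
    have h := (hf.implicitToOpenPartialHomeomorph f f' hf').continuousAt
      (hf.mem_implicitToOpenPartialHomeomorph_source hf')
    have h2 := (continuous_snd.continuousAt).tendsto.comp h.tendsto
    simpa [Function.comp_def] using h2
  refine ⟨_, inter_mem (hf.eq_implicitFunction hf')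
    (hΦ (inter_mem hs (Metric.ball_mem_nhds 0 one_pos))), ?_⟩
  have hsub : f ⁻¹' {f a} ∩ ({x | hf.implicitFunction f f' hf' (f x)
      (hf.implicitToOpenPartialHomeomorph f f' hf' x).2 = x} ∩
      (fun x => (hf.implicitToOpenPartialHomeomorph f f' hf' x).2) ⁻¹' (s ∩ Metric.ball 0 1)) ⊆
      hf.implicitFunction f f' hf' (f a) '' (s ∩ Metric.ball 0 1) := by
    rintro x ⟨hx, hx1, hx2⟩
    refine ⟨_, hx2, ?_⟩
    have hx' : f x = f a := hx
    rw [← hx']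
    exact hx1
  refine (measure_mono hsub).trans_lt ?_
  refine ((hK.mono Set.inter_subset_left).hausdorffMeasure_image_le
    (Nat.cast_nonneg d)).trans_lt ?_
  have hfin : Measure.hausdorffMeasure (d : ℝ)
      (Metric.ball (0 : (f' : E →ₗ[ℝ] F).ker) 1) < ∞ := by
    have := isAddHaarMeasure_hausdorffMeasure (E := (f' : E →ₗ[ℝ] F).ker)
    rw [hk] at this
    exact measure_ball_lt_top
  exact ENNReal.mul_lt_top (ENNReal.rpow_lt_top_of_nonneg (Nat.cast_nonneg d) ENNReal.coe_ne_top)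
    ((measure_mono Set.inter_subset_right).trans_lt hfin)

/-- A linear projection `P` of `E` onto the kernel is Lipschitz, so it cannot turn a null set into
one of positive measure. Composed with the implicit function it has the identity as derivative at 0,
so the projected fiber contains a neighbourhood in the kernel. -/
theorem hausdorffMeasure_fiber_ne_zero {f : E → F} {f' : E →L[ℝ] F} {a : E}
    (hf : HasStrictFDerivAt f f' a) (hf' : (f' : E →ₗ[ℝ] F).range = ⊤) {d : ℕ}
    (hd : d + Module.finrank ℝ F = Module.finrank ℝ E) :
    Measure.hausdorffMeasure (d : ℝ) (f ⁻¹' {f a}) ≠ 0 := by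
  have hk := finrank_ker_of_range_eq_top hf' hd
  have hE : CompleteSpace E := FiniteDimensional.complete ℝ E
  obtain ⟨p, hp⟩ := ((f' : E →ₗ[ℝ] F).ker.subtype).exists_leftInverse_of_injective
    (Submodule.ker_subtype _)
  set P : E →L[ℝ] (f' : E →ₗ[ℝ] F).ker := p.toContinuousLinearMap with hP
  set φ := hf.implicitFunction f f' hf' (f a) with hφ
  set s : Set (f' : E →ₗ[ℝ] F).ker := {y | f (φ y) = f a} with hs
  -- The implicit function solves the equation for all nearby values of `f`; only the value `f a`
  -- itself is kept.
  have hsn : s ∈ 𝓝 0 := by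
    have h := (hf.map_implicitFunction_eq hf')
    rw [nhds_prod_eq] at h
    exact h.curry.self_of_nhds
  have hder : HasStrictFDerivAt (fun y => P (φ y))
      (P.comp (f' : E →ₗ[ℝ] F).ker.subtypeL) 0 :=
    P.hasStrictFDerivAt.comp 0 (hf.to_implicitFunction hf')
  have hsurj : (P.comp (f' : E →ₗ[ℝ] F).ker.subtypeL :
      (f' : E →ₗ[ℝ] F).ker →ₗ[ℝ] (f' : E →ₗ[ℝ] F).ker).range = ⊤ := by
    rw [LinearMap.range_eq_top]
    intro y
    exact ⟨y, LinearMap.congr_fun hp y⟩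
  have hmap := hder.map_nhds_eq_of_surj hsurj
  have hmem : P '' (φ '' s) ∈ 𝓝 (P (φ 0)) := by
    rw [← hmap, Set.image_image]
    exact image_mem_map hsn
  have hpos : Measure.hausdorffMeasure (d : ℝ) (P '' (φ '' s)) ≠ 0 := by
    have := isAddHaarMeasure_hausdorffMeasure (E := (f' : E →ₗ[ℝ] F).ker)
    rw [hk] at this
    exact (Measure.measure_pos_of_mem_nhds _ hmem).ne'
  intro h0
  apply hpos
  have h1 := (P.lipschitz.lipschitzOnWith (s := φ '' s)).hausdorffMeasure_image_le
    (Nat.cast_nonneg d : (0 : ℝ) ≤ d)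
  have h2 : Measure.hausdorffMeasure (d : ℝ) (φ '' s) = 0 := by
    refine measure_mono_null ?_ h0
    rintro _ ⟨y, hy, rfl⟩
    exact hy
  rw [h2, mul_zero] at h1
  exact le_antisymm h1 bot_le

/-- A compact nonempty level set, regular in the sense that every vector is a directional
derivative of the (quadratic) map at each of its points, has finite and positive Hausdorff
measure in its dimension. -/
theorem hausdorffMeasure_level_pos_finite {f : E → F} (hf : ContDiff ℝ 1 f) {c : F}
    (hc : IsCompact (f ⁻¹' {c})) (hne : (f ⁻¹' {c}).Nonempty)
    (hreg : ∀ a, f a = c → ∀ v, ∃ h w, ∀ t : ℝ, f (a + t • h) = f a + t • v + t ^ 2 • w) {d : ℕ}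
    (hd : d + Module.finrank ℝ F = Module.finrank ℝ E) :
    Measure.hausdorffMeasure (d : ℝ) (f ⁻¹' {c}) ≠ 0 ∧
      Measure.hausdorffMeasure (d : ℝ) (f ⁻¹' {c}) < ∞ := by
  have hrange : ∀ a, f a = c → (fderiv ℝ f a : E →ₗ[ℝ] F).range = ⊤ := by
    intro a ha
    rw [LinearMap.range_eq_top]
    intro v
    obtain ⟨h, w, hq⟩ := hreg a ha v
    exact ⟨h, fderiv_apply_eq_of_quadratic ((hf.differentiable one_ne_zero) a) hq⟩
  have hstrict : ∀ a, HasStrictFDerivAt f (fderiv ℝ f a) a := fun a =>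
    hf.contDiffAt.hasStrictFDerivAt one_ne_zero
  constructor
  · obtain ⟨a, ha⟩ := hne
    have ha' : f a = c := ha
    rw [← ha']
    exact hausdorffMeasure_fiber_ne_zero (hstrict a) (hrange a ha') hd
  · refine hc.measure_lt_top_of_nhdsWithin ?_
    intro a ha
    have ha' : f a = c := ha
    obtain ⟨U, hU, hlt⟩ :=
      exists_nhds_hausdorffMeasure_fiber_lt_top (hstrict a) (hrange a ha') hd
    rw [ha'] at hlt
    exact ⟨_, inter_mem self_mem_nhdsWithin (mem_nhdsWithin_of_mem_nhds hU), hlt⟩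

end LevelSet

/-! ### The Hopf map in coordinates -/

@[simp] theorem quatI_re : quatI.re = 0 := rfl

@[simp] theorem quatI_imI : quatI.imI = 1 := rfl

@[simp] theorem quatI_imJ : quatI.imJ = 0 := rfl

@[simp] theorem quatI_imK : quatI.imK = 0 := rfl

@[simp] theorem quatJ_re : quatJ.re = 0 := rfl

@[simp] theorem quatJ_imI : quatJ.imI = 0 := rfl

@[simp] theorem quatJ_imJ : quatJ.imJ = 1 := rfl

@[simp] theorem quatJ_imK : quatJ.imK = 0 := rfl

theorem hopf_apply_zero (q : Quaternion ℝ) :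
    hopf q 0 = q.re ^ 2 + q.imI ^ 2 - q.imJ ^ 2 - q.imK ^ 2 := by
  simp [hopf]; ring

theorem hopf_apply_one (q : Quaternion ℝ) :
    hopf q 1 = 2 * (q.imI * q.imJ - q.re * q.imK) := by
  simp [hopf]; ring

theorem hopf_apply_two (q : Quaternion ℝ) :
    hopf q 2 = 2 * (q.re * q.imJ + q.imI * q.imK) := by
  simp [hopf]; ring

theorem quaternion_norm_sq (q : Quaternion ℝ) :
    ‖q‖ ^ 2 = q.re ^ 2 + q.imI ^ 2 + q.imJ ^ 2 + q.imK ^ 2 := by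
  rw [sq, ← Quaternion.normSq_eq_norm_mul_self, Quaternion.normSq_def']

theorem quaternion_inner (x y : Quaternion ℝ) :
    inner ℝ x y = x.re * y.re + x.imI * y.imI + x.imJ * y.imJ + x.imK * y.imK := by
  rw [Quaternion.inner_def]; simp

/-- For the complex structure of left multiplication by 𝐢, the numbers ⟨x, y⟩ and ⟨𝐢x, y⟩ are, up to
sign, the real and imaginary parts of the Hermitian product. This is the usual relation between its
squared modulus and the angle of the image points on the Hopf base. -/
theorem inner_hopf (x y : Quaternion ℝ) :
    inner ℝ (hopf x) (hopf y) =
      2 * (inner ℝ x y ^ 2 + inner ℝ (quatI * x) y ^ 2) - ‖x‖ ^ 2 * ‖y‖ ^ 2 := by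
  rw [PiLp.inner_apply, Fin.sum_univ_three, quaternion_inner, quaternion_inner,
    quaternion_norm_sq, quaternion_norm_sq]
  simp only [hopf_apply_zero, hopf_apply_one, hopf_apply_two, RCLike.inner_apply, conj_trivial]
  simp
  ring

theorem inner_hopf_self (x : Quaternion ℝ) : inner ℝ (hopf x) (hopf x) = ‖x‖ ^ 4 := by
  have h : ‖x‖ ^ 4 = (‖x‖ ^ 2) ^ 2 := by ring
  rw [PiLp.inner_apply, Fin.sum_univ_three, h, quaternion_norm_sq]
  simp only [hopf_apply_zero, hopf_apply_one, hopf_apply_two, RCLike.inner_apply, conj_trivial]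
  ring

theorem norm_hopf (x : Quaternion ℝ) : ‖hopf x‖ = ‖x‖ ^ 2 := by
  have h := inner_hopf_self x
  rw [real_inner_self_eq_norm_sq] at h
  have h2 : ‖hopf x‖ ^ 2 = (‖x‖ ^ 2) ^ 2 := by rw [h]; ring
  exact (pow_left_inj₀ (norm_nonneg _) (sq_nonneg _) two_ne_zero).1 h2

/-- Because 𝐣̄𝐢𝐣 = -𝐢. This is the symmetry that reverses a single edge. -/
theorem hopf_quatJ_mul (x : Quaternion ℝ) : hopf (quatJ * x) = -hopf x := by
  ext k
  fin_cases k
  · simp [hopf_apply_zero]; ring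
  · simp [hopf_apply_one]; ring
  · simp [hopf_apply_two]; ring

theorem hopf_quatI_mul (x : Quaternion ℝ) : hopf (quatI * x) = hopf x := by
  ext k
  fin_cases k
  · simp [hopf_apply_zero]; ring
  · simp [hopf_apply_one]; ring
  · simp [hopf_apply_two]; ring

theorem norm_quatI : ‖quatI‖ = 1 := by
  have h := quaternion_norm_sq quatI
  simp only [quatI_re, quatI_imI, quatI_imJ, quatI_imK] at h
  nlinarith [norm_nonneg quatI]

theorem norm_quatJ : ‖quatJ‖ = 1 := by
  have h := quaternion_norm_sq quatJ
  simp only [quatJ_re, quatJ_imI, quatJ_imJ, quatJ_imK] at h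
  nlinarith [norm_nonneg quatJ]

theorem contDiff_quaternion_re : ContDiff ℝ 1 fun q : Quaternion ℝ => q.re := by
  let l : Quaternion ℝ →ₗ[ℝ] ℝ := ⟨⟨fun q => q.re, fun _ _ => rfl⟩, fun _ _ => by simp⟩
  exact l.toContinuousLinearMap.contDiff

theorem contDiff_quaternion_imI : ContDiff ℝ 1 fun q : Quaternion ℝ => q.imI := by
  let l : Quaternion ℝ →ₗ[ℝ] ℝ := ⟨⟨fun q => q.imI, fun _ _ => rfl⟩, fun _ _ => by simp⟩
  exact l.toContinuousLinearMap.contDiff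

theorem contDiff_quaternion_imJ : ContDiff ℝ 1 fun q : Quaternion ℝ => q.imJ := by
  let l : Quaternion ℝ →ₗ[ℝ] ℝ := ⟨⟨fun q => q.imJ, fun _ _ => rfl⟩, fun _ _ => by simp⟩
  exact l.toContinuousLinearMap.contDiff

theorem contDiff_quaternion_imK : ContDiff ℝ 1 fun q : Quaternion ℝ => q.imK := by
  let l : Quaternion ℝ →ₗ[ℝ] ℝ := ⟨⟨fun q => q.imK, fun _ _ => rfl⟩, fun _ _ => by simp⟩
  exact l.toContinuousLinearMap.contDiff

theorem contDiff_hopf : ContDiff ℝ 1 hopf := by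
  rw [contDiff_euclidean]
  have h0 := contDiff_quaternion_re
  have h1 := contDiff_quaternion_imI
  have h2 := contDiff_quaternion_imJ
  have h3 := contDiff_quaternion_imK
  intro k
  fin_cases k
  · simp only [Fin.zero_eta, hopf_apply_zero]
    exact (((h0.pow 2).add (h1.pow 2)).sub (h2.pow 2)).sub (h3.pow 2)
  · simp only [Fin.mk_one, hopf_apply_one]
    exact contDiff_const.mul ((h1.mul h2).sub (h0.mul h3))
  · simp only [Fin.reduceFinMk, hopf_apply_two]
    exact contDiff_const.mul ((h0.mul h2).add (h1.mul h3))

theorem continuous_hopf : Continuous hopf := contDiff_hopf.continuous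

section Models

variable {n : ℕ}

theorem contDiff_eval (i : Fin n) : ContDiff ℝ 1 fun q : QuaternionSpace n => q i :=
  (PiLp.proj (𝕜 := ℝ) 2 (fun _ : Fin n => Quaternion ℝ) i).contDiff

theorem continuous_eval (i : Fin n) : Continuous fun q : QuaternionSpace n => q i :=
  (contDiff_eval i).continuous

theorem continuous_hopfMap : Continuous (hopfMap (n := n)) :=
  continuous_pi fun i => continuous_hopf.comp (continuous_eval i)

theorem sum_hopf_eq_zero_iff (q : QuaternionSpace n) :
    ∑ i, hopf (q i) = 0 ↔
      ∑ i, ((q i).re ^ 2 + (q i).imI ^ 2 - (q i).imJ ^ 2 - (q i).imK ^ 2) = 0 ∧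
      ∑ i, ((q i).imI * (q i).imJ - (q i).re * (q i).imK) = 0 ∧
      ∑ i, ((q i).re * (q i).imJ + (q i).imI * (q i).imK) = 0 := by
  have h : ∀ k, (∑ i, hopf (q i)) k = ∑ i, hopf (q i) k := fun k => by simp
  constructor
  · intro h0
    have h1 := h 0
    have h2 := h 1
    have h3 := h 2
    simp only [h0, hopf_apply_zero, hopf_apply_one, hopf_apply_two, ← Finset.mul_sum] at h1 h2 h3
    simp only [PiLp.zero_apply] at h1 h2 h3
    refine ⟨h1.symm, ?_, ?_⟩ <;> linarith
  · rintro ⟨h0, h1, h2⟩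
    ext k
    rw [h k]
    fin_cases k
    · simpa [hopf_apply_zero] using h0
    · simpa [hopf_apply_one, ← Finset.mul_sum] using h1
    · simpa [hopf_apply_two, ← Finset.mul_sum] using h2

/-! ### The model spaces as level sets -/

/-- All coordinates lie in `1 ⊕ 𝐣`, or all lie in `𝐢 ⊕ 𝐤`. -/
def IsPlanar (q : QuaternionSpace n) : Prop :=
  (∀ i, (q i).imI = 0 ∧ (q i).imK = 0) ∨ (∀ i, (q i).re = 0 ∧ (q i).imJ = 0)

theorem norm_sq_eq_sum (q : QuaternionSpace n) : ‖q‖ ^ 2 = ∑ i, ‖q i‖ ^ 2 :=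
  PiLp.norm_sq_eq_of_L2 _ q

theorem mem_arm3Model {q : QuaternionSpace n} : q ∈ arm3Model n ↔ ‖q‖ ^ 2 = 2 := by
  rw [arm3Model, mem_sphere_zero_iff_norm, ← Real.sqrt_sq (norm_nonneg q),
    Real.sqrt_inj (sq_nonneg _) zero_le_two, Real.sqrt_sq (norm_nonneg q)]

theorem mem_arm2Model {q : QuaternionSpace n} :
    q ∈ arm2Model n ↔ ‖q‖ ^ 2 = 2 ∧ IsPlanar q := by
  simp only [arm2Model, Set.mem_union, Set.mem_ofPred_eq, mem_arm3Model, IsPlanar, and_or_left]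

theorem coeComplex_add_coeComplex_mul_quatJ (a b : ℂ) :
    Quaternion.coeComplex a + Quaternion.coeComplex b * quatJ = ⟨a.re, a.im, b.re, b.im⟩ := by
  ext <;> simp

theorem coe_add_coe_mul_quatJ (a b : ℝ) :
    (a : Quaternion ℝ) + (b : Quaternion ℝ) * quatJ = ⟨a, 0, b, 0⟩ := by
  ext <;> simp

theorem quatI_mul_coe_add_coe_mul_quatJ (a b : ℝ) :
    quatI * ((a : Quaternion ℝ) + (b : Quaternion ℝ) * quatJ) = ⟨0, a, 0, b⟩ := by
  ext <;> simp

theorem norm_eq_one_iff_norm_sq {V : Type*} [NormedAddCommGroup V] (u : V) :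
    ‖u‖ = 1 ↔ ‖u‖ ^ 2 = 1 := by
  rw [pow_eq_one_iff_of_nonneg (norm_nonneg _) two_ne_zero]

/-- The Hopf vectors of u + v𝐣 sum to |u|² - |v|² along 𝐢 and, up to signs, twice the two parts of
the Hermitian product of u and v in the other directions. So closure says that u and v are
orthogonal of equal norm, and total norm squared 2 makes both norms 1. -/
theorem mem_pol3Model {q : QuaternionSpace n} :
    q ∈ pol3Model n ↔ ‖q‖ ^ 2 = 2 ∧ ∑ i, hopf (q i) = 0 := by
  have key : ∀ u v : EuclideanSpace ℂ (Fin n),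
      (‖u‖ = 1 ∧ ‖v‖ = 1 ∧ inner ℂ u v = 0) ↔
      (∑ i, ((u i).re ^ 2 + (u i).im ^ 2) = 1 ∧ ∑ i, ((v i).re ^ 2 + (v i).im ^ 2) = 1 ∧
        ∑ i, ((u i).re * (v i).re + (u i).im * (v i).im) = 0 ∧
        ∑ i, ((u i).im * (v i).re - (u i).re * (v i).im) = 0) := by
    intro u v
    have h1 : ∀ u : EuclideanSpace ℂ (Fin n),
        ‖u‖ = 1 ↔ ∑ i, ((u i).re ^ 2 + (u i).im ^ 2) = 1 := by
      intro u
      rw [norm_eq_one_iff_norm_sq, PiLp.norm_sq_eq_of_L2]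
      simp only [Complex.sq_norm, Complex.normSq_apply, ← sq]
    have h2 : inner ℂ u v = 0 ↔
        ∑ i, ((u i).re * (v i).re + (u i).im * (v i).im) = 0 ∧
        ∑ i, ((u i).im * (v i).re - (u i).re * (v i).im) = 0 := by
      rw [PiLp.inner_apply, Complex.ext_iff, Complex.re_sum, Complex.im_sum]
      simp only [RCLike.inner_apply, Complex.mul_re, Complex.mul_im, Complex.conj_re,
        Complex.conj_im, Complex.zero_re, Complex.zero_im]
      refine and_congr ?_ ?_
      · rw [Finset.sum_congr rfl fun i _ => ?_]
        ring
      · rw [← neg_eq_zero, ← Finset.sum_neg_distrib, Finset.sum_congr rfl fun i _ => ?_]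
        ring
    rw [h1, h1, h2]
  rw [sum_hopf_eq_zero_iff, norm_sq_eq_sum]
  simp only [quaternion_norm_sq]
  constructor
  · rintro ⟨u, v, hu, hv, huv, hq⟩
    obtain ⟨h1, h2, h3, h4⟩ := (key u v).1 ⟨hu, hv, huv⟩
    simp only [hq, coeComplex_add_coeComplex_mul_quatJ]
    simp only [Finset.sum_add_distrib, Finset.sum_sub_distrib] at h1 h2 h3 h4 ⊢
    refine ⟨?_, ?_, ?_, ?_⟩ <;> linarith
  · rintro ⟨h1, h2, h3, h4⟩
    refine ⟨WithLp.toLp 2 fun i => ⟨(q i).re, (q i).imI⟩,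
      WithLp.toLp 2 fun i => ⟨(q i).imJ, (q i).imK⟩, ?_⟩
    rw [← and_assoc, ← and_assoc, and_assoc (a := ‖_‖ = 1), key]
    simp only [coeComplex_add_coeComplex_mul_quatJ]
    simp only [Finset.sum_add_distrib, Finset.sum_sub_distrib] at h1 h2 h3 h4 ⊢
    refine ⟨⟨?_, ?_, ?_, ?_⟩, fun i => rfl⟩ <;> linarith

theorem mem_pol2Model {q : QuaternionSpace n} :
    q ∈ pol2Model n ↔ ‖q‖ ^ 2 = 2 ∧ ∑ i, hopf (q i) = 0 ∧ IsPlanar q := by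
  have key : ∀ u v : EuclideanSpace ℝ (Fin n),
      (‖u‖ = 1 ∧ ‖v‖ = 1 ∧ inner ℝ u v = 0) ↔
      (∑ i, (u i) ^ 2 = 1 ∧ ∑ i, (v i) ^ 2 = 1 ∧ ∑ i, (u i) * (v i) = 0) := by
    intro u v
    rw [norm_eq_one_iff_norm_sq, norm_eq_one_iff_norm_sq, PiLp.norm_sq_eq_of_L2,
      PiLp.norm_sq_eq_of_L2, PiLp.inner_apply]
    simp only [Real.norm_eq_abs, sq_abs, RCLike.inner_apply, conj_trivial, mul_comm]
  rw [sum_hopf_eq_zero_iff, norm_sq_eq_sum]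
  simp only [quaternion_norm_sq]
  constructor
  · rintro ⟨u, v, hu, hv, huv, hq | hq⟩
    · obtain ⟨h1, h2, h3⟩ := (key u v).1 ⟨hu, hv, huv⟩
      simp only [IsPlanar, hq, coe_add_coe_mul_quatJ]
      simp [Finset.sum_add_distrib, Finset.sum_sub_distrib, h1, h2, h3]
      norm_num
    · obtain ⟨h1, h2, h3⟩ := (key u v).1 ⟨hu, hv, huv⟩
      simp only [IsPlanar, hq, quatI_mul_coe_add_coe_mul_quatJ]
      simp [Finset.sum_add_distrib, Finset.sum_sub_distrib, h1, h2, h3]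
      norm_num
  · rintro ⟨h1, ⟨h2, h3, h4⟩, h | h⟩
    · refine ⟨WithLp.toLp 2 fun i => (q i).re, WithLp.toLp 2 fun i => (q i).imJ, ?_⟩
      rw [← and_assoc, ← and_assoc, and_assoc (a := ‖_‖ = 1), key]
      simp only [coe_add_coe_mul_quatJ]
      simp only [(h _).1, (h _).2, Finset.sum_add_distrib, Finset.sum_sub_distrib] at h1 h2 h3 h4
      simp at h1 h2 h3 h4
      refine ⟨⟨?_, ?_, ?_⟩, Or.inl fun i => ?_⟩
      · linarith
      · linarith
      · linarith
      · ext <;> simp [h i]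
    · refine ⟨WithLp.toLp 2 fun i => (q i).imI, WithLp.toLp 2 fun i => (q i).imK, ?_⟩
      rw [← and_assoc, ← and_assoc, and_assoc (a := ‖_‖ = 1), key]
      simp only [quatI_mul_coe_add_coe_mul_quatJ]
      simp only [(h _).1, (h _).2, Finset.sum_add_distrib, Finset.sum_sub_distrib] at h1 h2 h3 h4
      simp at h1 h2 h3 h4
      refine ⟨⟨?_, ?_, ?_⟩, Or.inr fun i => ?_⟩
      · linarith
      · linarith
      · linarith
      · ext <;> simp [h i]

end Models

/-! ### The models have finite positive volume -/

theorem finrank_piLp_two {V : Type*} [NormedAddCommGroup V] [NormedSpace ℝ V]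
    [FiniteDimensional ℝ V] (n : ℕ) :
    Module.finrank ℝ (PiLp 2 fun _ : Fin n => V) = n * Module.finrank ℝ V := by
  rw [(WithLp.linearEquiv 2 ℝ (Fin n → V)).finrank_eq, Module.finrank_pi_fintype]
  simp

theorem hausdorffMeasure_normSq_level {E : Type*} [NormedAddCommGroup E] [InnerProductSpace ℝ E]
    [FiniteDimensional ℝ E] [MeasurableSpace E] [BorelSpace E] {d : ℕ}
    (hd : d + 1 = Module.finrank ℝ E) :
    Measure.hausdorffMeasure (d : ℝ) {x : E | ‖x‖ ^ 2 = 2} ≠ 0 ∧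
      Measure.hausdorffMeasure (d : ℝ) {x : E | ‖x‖ ^ 2 = 2} < ∞ := by
  have hnt : Nontrivial E := Module.nontrivial_of_finrank_pos (R := ℝ) (by omega)
  have hset : (fun x : E => ‖x‖ ^ 2) ⁻¹' {2} = Metric.sphere 0 (Real.sqrt 2) := by
    ext x
    rw [mem_sphere_zero_iff_norm, Set.mem_preimage, Set.mem_singleton_iff,
      ← Real.sqrt_inj (sq_nonneg _) zero_le_two, Real.sqrt_sq (norm_nonneg x)]
  have hpr : ProperSpace E := FiniteDimensional.proper ℝ E
  refine hausdorffMeasure_level_pos_finite (f := fun x : E => ‖x‖ ^ 2) (c := 2)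
    (contDiff_norm_sq ℝ) ?_ ?_ ?_ (by rwa [Module.finrank_self])
  · rw [hset]
    exact isCompact_sphere _ _
  · rw [hset]
    exact NormedSpace.sphere_nonempty.2 (Real.sqrt_nonneg 2)
  · intro a ha v
    -- A radial direction c • a changes ‖·‖² at rate 2c‖a‖² = 4c.
    refine ⟨(v / 4) • a, v ^ 2 / 8, fun t => ?_⟩
    have h : a + t • (v / 4) • a = (1 + t * (v / 4)) • a := by module
    simp only [h, norm_smul, mul_pow, Real.norm_eq_abs, sq_abs, smul_eq_mul] at ha ⊢
    rw [ha]
    ring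

theorem hausdorffMeasure_arm3Model {n : ℕ} (hn : 1 ≤ n) :
    Measure.hausdorffMeasure (4 * (n : ℝ) - 1) (arm3Model n) ≠ 0 ∧
      Measure.hausdorffMeasure (4 * (n : ℝ) - 1) (arm3Model n) < ∞ := by
  have hd : (4 * (n : ℝ) - 1) = ((4 * n - 1 : ℕ) : ℝ) := by
    rw [Nat.cast_sub (by omega)]
    push_cast
    ring
  have hM : arm3Model n = {q : QuaternionSpace n | ‖q‖ ^ 2 = 2} := by
    ext q
    exact mem_arm3Model
  rw [hd, hM]
  refine hausdorffMeasure_normSq_level ?_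
  rw [finrank_piLp_two, Quaternion.finrank_eq_four]
  omega

theorem isCompact_arm3Model (n : ℕ) : IsCompact (arm3Model n) := isCompact_sphere _ _

/-- The point of `1 ⊕ 𝐣` with the given complex coordinate. -/
def realPlane (z : ℂ) : Quaternion ℝ := ⟨z.re, 0, z.im, 0⟩

@[simp] theorem realPlane_re (z : ℂ) : (realPlane z).re = z.re := rfl

@[simp] theorem realPlane_imI (z : ℂ) : (realPlane z).imI = 0 := rfl

@[simp] theorem realPlane_imJ (z : ℂ) : (realPlane z).imJ = z.im := rfl

@[simp] theorem realPlane_imK (z : ℂ) : (realPlane z).imK = 0 := rfl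

/-- The point of `𝐢 ⊕ 𝐤` with the given complex coordinate. -/
def imagPlane (z : ℂ) : Quaternion ℝ := ⟨0, z.re, 0, z.im⟩

@[simp] theorem imagPlane_re (z : ℂ) : (imagPlane z).re = 0 := rfl

@[simp] theorem imagPlane_imI (z : ℂ) : (imagPlane z).imI = z.re := rfl

@[simp] theorem imagPlane_imJ (z : ℂ) : (imagPlane z).imJ = 0 := rfl

@[simp] theorem imagPlane_imK (z : ℂ) : (imagPlane z).imK = z.im := rfl

/-- The embedding of `ℂⁿ` into `ℍⁿ` as `(1 ⊕ 𝐣)ⁿ`. -/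
def realPlaneEmbedding (n : ℕ) : EuclideanSpace ℂ (Fin n) →ₗᵢ[ℝ] QuaternionSpace n where
  toFun z := WithLp.toLp 2 fun i => realPlane (z i)
  map_add' z w := by
    ext i <;> simp
  map_smul' c z := by
    ext i <;> simp
  norm_map' z := by
    rw [← pow_left_inj₀ (norm_nonneg _) (norm_nonneg _) two_ne_zero, norm_sq_eq_sum,
      PiLp.norm_sq_eq_of_L2]
    refine Finset.sum_congr rfl fun i _ => ?_
    rw [quaternion_norm_sq, Complex.sq_norm, Complex.normSq_apply]
    simp [sq]

/-- The embedding of `ℂⁿ` into `ℍⁿ` as `(𝐢 ⊕ 𝐤)ⁿ`. -/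
def imagPlaneEmbedding (n : ℕ) : EuclideanSpace ℂ (Fin n) →ₗᵢ[ℝ] QuaternionSpace n where
  toFun z := WithLp.toLp 2 fun i => imagPlane (z i)
  map_add' z w := by
    ext i <;> simp
  map_smul' c z := by
    ext i <;> simp
  norm_map' z := by
    rw [← pow_left_inj₀ (norm_nonneg _) (norm_nonneg _) two_ne_zero, norm_sq_eq_sum,
      PiLp.norm_sq_eq_of_L2]
    refine Finset.sum_congr rfl fun i _ => ?_
    rw [quaternion_norm_sq, Complex.sq_norm, Complex.normSq_apply]
    simp [sq]

theorem realPlaneEmbedding_apply {n : ℕ} (z : EuclideanSpace ℂ (Fin n)) (i : Fin n) :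
    realPlaneEmbedding n z i = realPlane (z i) := rfl

theorem imagPlaneEmbedding_apply {n : ℕ} (z : EuclideanSpace ℂ (Fin n)) (i : Fin n) :
    imagPlaneEmbedding n z i = imagPlane (z i) := rfl

theorem isPlanar_iff_exists {n : ℕ} {q : QuaternionSpace n} :
    IsPlanar q ↔ (∃ z, realPlaneEmbedding n z = q) ∨ ∃ z, imagPlaneEmbedding n z = q := by
  refine or_congr ⟨fun h => ?_, ?_⟩ ⟨fun h => ?_, ?_⟩
  · refine ⟨WithLp.toLp 2 fun i => ⟨(q i).re, (q i).imJ⟩, ?_⟩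
    ext i <;> simp [realPlaneEmbedding_apply, h i]
  · rintro ⟨z, rfl⟩ i
    exact ⟨rfl, rfl⟩
  · refine ⟨WithLp.toLp 2 fun i => ⟨(q i).imI, (q i).imK⟩, ?_⟩
    ext i <;> simp [imagPlaneEmbedding_apply, h i]
  · rintro ⟨z, rfl⟩ i
    exact ⟨rfl, rfl⟩

theorem sum_sq_eq_zero_iff {n : ℕ} (z : EuclideanSpace ℂ (Fin n)) :
    ∑ i, z i ^ 2 = 0 ↔ ∑ i, ((z i).re ^ 2 - (z i).im ^ 2) = 0 ∧ ∑ i, (z i).re * (z i).im = 0 := by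
  rw [Complex.ext_iff, Complex.re_sum, Complex.im_sum]
  simp only [sq, Complex.mul_re, Complex.mul_im, Complex.zero_re, Complex.zero_im]
  refine and_congr Iff.rfl ?_
  have h : ∑ i, ((z i).re * (z i).im + (z i).im * (z i).re) = 2 * ∑ i, (z i).re * (z i).im := by
    rw [Finset.mul_sum]
    exact Finset.sum_congr rfl fun i _ => by ring
  rw [h]
  simp

/-- In either plane the Hopf map is complex squaring z ↦ z², with values in the 𝐢-𝐤 plane. -/
theorem sum_hopf_realPlaneEmbedding {n : ℕ} (z : EuclideanSpace ℂ (Fin n)) :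
    ∑ i, hopf (realPlaneEmbedding n z i) = 0 ↔ ∑ i, z i ^ 2 = 0 := by
  rw [sum_hopf_eq_zero_iff, sum_sq_eq_zero_iff]
  simp [realPlaneEmbedding_apply]

theorem sum_hopf_imagPlaneEmbedding {n : ℕ} (z : EuclideanSpace ℂ (Fin n)) :
    ∑ i, hopf (imagPlaneEmbedding n z i) = 0 ↔ ∑ i, z i ^ 2 = 0 := by
  rw [sum_hopf_eq_zero_iff, sum_sq_eq_zero_iff]
  simp [imagPlaneEmbedding_apply]

theorem arm2Model_eq (n : ℕ) :
    arm2Model n = realPlaneEmbedding n '' {z | ‖z‖ ^ 2 = 2} ∪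
      imagPlaneEmbedding n '' {z | ‖z‖ ^ 2 = 2} := by
  ext q
  rw [mem_arm2Model, isPlanar_iff_exists, and_or_left]
  refine or_congr ⟨?_, ?_⟩ ⟨?_, ?_⟩
  · rintro ⟨h, z, rfl⟩
    exact ⟨z, by simpa using h, rfl⟩
  · rintro ⟨z, h, rfl⟩
    exact ⟨by simpa using h, z, rfl⟩
  · rintro ⟨h, z, rfl⟩
    exact ⟨z, by simpa using h, rfl⟩
  · rintro ⟨z, h, rfl⟩
    exact ⟨by simpa using h, z, rfl⟩

theorem pol2Model_eq (n : ℕ) :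
    pol2Model n = realPlaneEmbedding n '' {z | ‖z‖ ^ 2 = 2 ∧ ∑ i, z i ^ 2 = 0} ∪
      imagPlaneEmbedding n '' {z | ‖z‖ ^ 2 = 2 ∧ ∑ i, z i ^ 2 = 0} := by
  ext q
  rw [mem_pol2Model, isPlanar_iff_exists, ← and_assoc, and_or_left]
  refine or_congr ⟨?_, ?_⟩ ⟨?_, ?_⟩
  · rintro ⟨⟨h, h'⟩, z, rfl⟩
    exact ⟨z, ⟨by simpa using h, (sum_hopf_realPlaneEmbedding z).1 h'⟩, rfl⟩
  · rintro ⟨z, ⟨h, h'⟩, rfl⟩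
    exact ⟨⟨by simpa using h, (sum_hopf_realPlaneEmbedding z).2 h'⟩, z, rfl⟩
  · rintro ⟨⟨h, h'⟩, z, rfl⟩
    exact ⟨z, ⟨by simpa using h, (sum_hopf_imagPlaneEmbedding z).1 h'⟩, rfl⟩
  · rintro ⟨z, ⟨h, h'⟩, rfl⟩
    exact ⟨⟨by simpa using h, (sum_hopf_imagPlaneEmbedding z).2 h'⟩, z, rfl⟩

theorem hausdorffMeasure_planar_union {n : ℕ} {S : Set (EuclideanSpace ℂ (Fin n))} {d : ℕ}
    (hS : Measure.hausdorffMeasure (d : ℝ) S ≠ 0 ∧ Measure.hausdorffMeasure (d : ℝ) S < ∞) :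
    Measure.hausdorffMeasure (d : ℝ) (realPlaneEmbedding n '' S ∪ imagPlaneEmbedding n '' S) ≠ 0 ∧
      Measure.hausdorffMeasure (d : ℝ)
        (realPlaneEmbedding n '' S ∪ imagPlaneEmbedding n '' S) < ∞ := by
  have h1 := (realPlaneEmbedding n).isometry.hausdorffMeasure_image
    (Or.inl (Nat.cast_nonneg d : (0 : ℝ) ≤ d)) S
  have h2 := (imagPlaneEmbedding n).isometry.hausdorffMeasure_image
    (Or.inl (Nat.cast_nonneg d : (0 : ℝ) ≤ d)) S
  refine ⟨fun h => hS.1 ?_, measure_union_lt_top (h1 ▸ hS.2) (h2 ▸ hS.2)⟩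
  rw [← h1]
  exact measure_mono_null Set.subset_union_left h

/-! ### Compactness and volume of the planar and closed models -/

theorem isCompact_normSq_level {E : Type*} [NormedAddCommGroup E] [ProperSpace E] :
    IsCompact {x : E | ‖x‖ ^ 2 = 2} := by
  refine (isCompact_closedBall (0 : E) 2).of_isClosed_subset
    (isClosed_eq (by fun_prop) continuous_const) fun x hx => ?_
  have hx' : ‖x‖ ^ 2 = 2 := hx
  rw [mem_closedBall_zero_iff]
  nlinarith [norm_nonneg x]

theorem isCompact_arm2Model (n : ℕ) : IsCompact (arm2Model n) := by
  rw [arm2Model_eq]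
  exact (isCompact_normSq_level.image (realPlaneEmbedding n).continuous).union
    (isCompact_normSq_level.image (imagPlaneEmbedding n).continuous)

theorem isCompact_isotropic_level (n : ℕ) :
    IsCompact {z : EuclideanSpace ℂ (Fin n) | ‖z‖ ^ 2 = 2 ∧ ∑ i, z i ^ 2 = 0} :=
  isCompact_normSq_level.inter_right (isClosed_eq (by fun_prop) continuous_const)

theorem isCompact_pol2Model (n : ℕ) : IsCompact (pol2Model n) := by
  rw [pol2Model_eq]
  exact ((isCompact_isotropic_level n).image (realPlaneEmbedding n).continuous).union
    ((isCompact_isotropic_level n).image (imagPlaneEmbedding n).continuous)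

theorem continuous_sum_hopf (n : ℕ) :
    Continuous fun q : QuaternionSpace n => ∑ i, hopf (q i) :=
  continuous_finsetSum _ fun i _ => continuous_hopf.comp (continuous_eval i)

theorem isCompact_pol3Model (n : ℕ) : IsCompact (pol3Model n) := by
  have h : pol3Model n = {q : QuaternionSpace n | ‖q‖ ^ 2 = 2 ∧ ∑ i, hopf (q i) = 0} := by
    ext q
    exact mem_pol3Model
  rw [h]
  exact isCompact_normSq_level.inter_right
    (isClosed_eq (continuous_sum_hopf n) continuous_const)

theorem hausdorffMeasure_arm2Model {n : ℕ} (hn : 1 ≤ n) :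
    Measure.hausdorffMeasure (2 * (n : ℝ) - 1) (arm2Model n) ≠ 0 ∧
      Measure.hausdorffMeasure (2 * (n : ℝ) - 1) (arm2Model n) < ∞ := by
  have hd : (2 * (n : ℝ) - 1) = ((2 * n - 1 : ℕ) : ℝ) := by
    rw [Nat.cast_sub (by omega)]
    push_cast
    ring
  rw [hd, arm2Model_eq]
  refine hausdorffMeasure_planar_union (hausdorffMeasure_normSq_level ?_)
  rw [finrank_piLp_two, Complex.finrank_real_complex]
  omega

/-- Nonemptiness of both closed models rests on this point; it is the frame of the first two basis
vectors, so two edges are required. -/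
theorem exists_isotropic {n : ℕ} (hn : 2 ≤ n) :
    ∃ z : EuclideanSpace ℂ (Fin n), ‖z‖ ^ 2 = 2 ∧ ∑ i, z i ^ 2 = 0 := by
  let a : Fin n := ⟨0, by omega⟩
  let b : Fin n := ⟨1, by omega⟩
  have hab : a ≠ b := by simp [a, b]
  refine ⟨WithLp.toLp 2 fun i => if i = a then 1 else if i = b then Complex.I else 0, ?_, ?_⟩
  · rw [PiLp.norm_sq_eq_of_L2, Fintype.sum_eq_add a b hab]
    · simp [hab.symm]
      norm_num
    · rintro x ⟨h1, h2⟩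
      simp [h1, h2]
  · rw [Fintype.sum_eq_add a b hab]
    · simp [hab.symm]
    · rintro x ⟨h1, h2⟩
      simp [h1, h2]

theorem hausdorffMeasure_pol2Model {n : ℕ} (hn : 2 ≤ n) :
    Measure.hausdorffMeasure (2 * (n : ℝ) - 3) (pol2Model n) ≠ 0 ∧
      Measure.hausdorffMeasure (2 * (n : ℝ) - 3) (pol2Model n) < ∞ := by
  have hd : (2 * (n : ℝ) - 3) = ((2 * n - 3 : ℕ) : ℝ) := by
    rw [Nat.cast_sub (by omega)]
    push_cast
    ring
  rw [hd, pol2Model_eq]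
  refine hausdorffMeasure_planar_union ?_
  have hset : {z : EuclideanSpace ℂ (Fin n) | ‖z‖ ^ 2 = 2 ∧ ∑ i, z i ^ 2 = 0} =
      (fun z : EuclideanSpace ℂ (Fin n) => (‖z‖ ^ 2, ∑ i, z i ^ 2)) ⁻¹' {((2 : ℝ), (0 : ℂ))} := by
    ext z
    simp
  have hcpt := isCompact_isotropic_level n
  rw [hset] at hcpt ⊢
  refine hausdorffMeasure_level_pos_finite ?_ hcpt ?_ ?_ ?_
  · refine (contDiff_norm_sq ℝ).prodMk (ContDiff.sum fun i _ => ContDiff.pow ?_ 2)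
    exact (PiLp.proj (𝕜 := ℝ) 2 (fun _ : Fin n => ℂ) i).contDiff
  · obtain ⟨z, hz⟩ := exists_isotropic hn
    exact ⟨z, hset ▸ hz⟩
  · rintro a ha ⟨s, p⟩
    rw [Prod.mk.injEq] at ha
    obtain ⟨ha1, ha2⟩ := ha
    -- On the level set Σ a_i ā_i = 2 and Σ a_i² = 0. Hence the multiple of a moves only ‖·‖², at
    -- rate 2 · (s/4) · 2 = s, and the multiple of its conjugate moves only Σ z_i², at rate 2 ·
    -- (p/4) · 2 = p.
    let h : EuclideanSpace ℂ (Fin n) :=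
      WithLp.toLp 2 fun i => ((s / 4 : ℝ) : ℂ) * a i + p / 4 * (starRingEnd ℂ) (a i)
    have hh : ∀ i, h i = ((s / 4 : ℝ) : ℂ) * a i + p / 4 * (starRingEnd ℂ) (a i) := fun i => rfl
    have hnorm : ∑ i, a i * (starRingEnd ℂ) (a i) = 2 := by
      have h1 : ((‖a‖ ^ 2 : ℝ) : ℂ) = 2 := by rw [ha1]; norm_num
      rw [PiLp.norm_sq_eq_of_L2] at h1
      rw [← h1]
      push_cast
      exact Finset.sum_congr rfl fun i _ => Complex.mul_conj' (a i)
    have hconj : ∑ i, (starRingEnd ℂ) (a i) ^ 2 = 0 := by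
      have h1 := congrArg (starRingEnd ℂ) ha2
      simpa using h1
    have hinner : inner ℝ a h = s / 2 := by
      have h1 : inner ℝ a h = (∑ i, (starRingEnd ℂ) (a i) * h i).re := by
        rw [PiLp.inner_apply, Complex.re_sum]
        exact Finset.sum_congr rfl fun i _ => by rw [Complex.inner, mul_comm]
      have h2 : ∑ i, (starRingEnd ℂ) (a i) * h i = ((s / 2 : ℝ) : ℂ) := by
        calc ∑ i, (starRingEnd ℂ) (a i) * h i
            = ((s / 4 : ℝ) : ℂ) * ∑ i, a i * (starRingEnd ℂ) (a i) +
                p / 4 * ∑ i, (starRingEnd ℂ) (a i) ^ 2 := by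
              rw [Finset.mul_sum, Finset.mul_sum, ← Finset.sum_add_distrib]
              exact Finset.sum_congr rfl fun i _ => by rw [hh]; ring
          _ = ((s / 2 : ℝ) : ℂ) := by
              rw [hnorm, hconj]
              push_cast
              ring
      rw [h1, h2, Complex.ofReal_re]
    refine ⟨h, (‖h‖ ^ 2, ∑ i, h i ^ 2), fun t => ?_⟩
    refine Prod.ext ?_ ?_
    · simp only [Prod.fst_add, Prod.smul_fst, smul_eq_mul]
      rw [norm_add_sq_real, inner_smul_right, hinner, norm_smul, mul_pow, Real.norm_eq_abs, sq_abs]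
      ring
    · simp only [Prod.snd_add, Prod.smul_snd, Complex.real_smul, PiLp.add_apply, PiLp.smul_apply]
      have h3 : ∑ i, 2 * (a i * h i) = p := by
        calc ∑ i, 2 * (a i * h i)
            = ((s / 2 : ℝ) : ℂ) * ∑ i, a i ^ 2 +
                p / 2 * ∑ i, a i * (starRingEnd ℂ) (a i) := by
              rw [Finset.mul_sum, Finset.mul_sum, ← Finset.sum_add_distrib]
              exact Finset.sum_congr rfl fun i _ => by rw [hh]; push_cast; ring
          _ = p := by
              rw [hnorm, ha2]
              ring
      calc ∑ i, (a i + t * h i) ^ 2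
          = ∑ i, a i ^ 2 + t * ∑ i, 2 * (a i * h i) + t ^ 2 * ∑ i, h i ^ 2 := by
            rw [Finset.mul_sum, Finset.mul_sum, ← Finset.sum_add_distrib,
              ← Finset.sum_add_distrib]
            exact Finset.sum_congr rfl fun i _ => by ring
        _ = _ := by
            rw [h3]
            push_cast
            ring
  · rw [finrank_piLp_two, Complex.finrank_real_complex, Module.finrank_prod,
      Complex.finrank_real_complex, Module.finrank_self]
    omega

/-- The imaginary quaternion with the given vector of coordinates. -/
def imagQuaternion (p : EuclideanSpace ℝ (Fin 3)) : Quaternion ℝ := ⟨0, p 0, p 1, p 2⟩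

@[simp] theorem imagQuaternion_re (p : EuclideanSpace ℝ (Fin 3)) : (imagQuaternion p).re = 0 := rfl

@[simp] theorem imagQuaternion_imI (p : EuclideanSpace ℝ (Fin 3)) :
    (imagQuaternion p).imI = p 0 := rfl

@[simp] theorem imagQuaternion_imJ (p : EuclideanSpace ℝ (Fin 3)) :
    (imagQuaternion p).imJ = p 1 := rfl

@[simp] theorem imagQuaternion_imK (p : EuclideanSpace ℝ (Fin 3)) :
    (imagQuaternion p).imK = p 2 := rfl

/-- Since x̄𝐢(𝐢xp) = -‖x‖²p, and the conjugate term contributes the same, the direction 𝐢xp moves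
the Hopf image by -2‖x‖²p. The result depends on `x` only through its norm, so one common `p` in all
coordinates steers the closure vector. -/
theorem hopf_add_smul (x : Quaternion ℝ) (s : ℝ) (p : EuclideanSpace ℝ (Fin 3)) (t : ℝ) :
    hopf (x + t • (s • x + quatI * x * imagQuaternion p)) =
      hopf x + t • ((2 * s) • hopf x - (2 * ‖x‖ ^ 2) • p) +
        t ^ 2 • hopf (s • x + quatI * x * imagQuaternion p) := by
  rw [quaternion_norm_sq]
  ext k
  fin_cases k
  · simp [hopf_apply_zero]; ring
  · simp [hopf_apply_one]; ring
  · simp [hopf_apply_two]; ring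

theorem inner_smul_add_quatI_mul (x : Quaternion ℝ) (s : ℝ) (p : EuclideanSpace ℝ (Fin 3)) :
    inner ℝ x (s • x + quatI * x * imagQuaternion p) = s * ‖x‖ ^ 2 - inner ℝ (hopf x) p := by
  rw [quaternion_norm_sq, quaternion_inner, PiLp.inner_apply, Fin.sum_univ_three]
  simp [hopf_apply_zero, hopf_apply_one, hopf_apply_two]
  ring

theorem hausdorffMeasure_pol3Model {n : ℕ} (hn : 2 ≤ n) :
    Measure.hausdorffMeasure (4 * (n : ℝ) - 4) (pol3Model n) ≠ 0 ∧
      Measure.hausdorffMeasure (4 * (n : ℝ) - 4) (pol3Model n) < ∞ := by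
  have hd : (4 * (n : ℝ) - 4) = ((4 * n - 4 : ℕ) : ℝ) := by
    rw [Nat.cast_sub (by omega)]
    push_cast
    ring
  have hset : pol3Model n = (fun q : QuaternionSpace n => (‖q‖ ^ 2, ∑ i, hopf (q i))) ⁻¹'
      {((2 : ℝ), (0 : EuclideanSpace ℝ (Fin 3)))} := by
    ext q
    simp [mem_pol3Model]
  have hcpt := isCompact_pol3Model n
  rw [hd]
  rw [hset] at hcpt ⊢
  refine hausdorffMeasure_level_pos_finite ?_ hcpt ?_ ?_ ?_
  · exact (contDiff_norm_sq ℝ).prodMk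
      (ContDiff.sum fun i _ => contDiff_hopf.comp (contDiff_eval i))
  · obtain ⟨z, hz1, hz2⟩ := exists_isotropic hn
    refine ⟨realPlaneEmbedding n z, ?_⟩
    rw [Set.mem_preimage, (sum_hopf_realPlaneEmbedding z).2 hz2, LinearIsometry.norm_map, hz1]
    rfl
  · rintro a ha ⟨s, p⟩
    rw [Prod.mk.injEq] at ha
    obtain ⟨ha1, ha2⟩ := ha
    -- As Σ ‖a_i‖² = 2, the second term moves Σ hopf at rate -4 · (-1/4)p = p. The first moves ‖·‖²
    -- at rate s and leaves Σ hopf stationary, because that sum vanishes at a.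
    let h : QuaternionSpace n := WithLp.toLp 2 fun i =>
      (s / 4) • a i + quatI * a i * imagQuaternion ((-1 / 4 : ℝ) • p)
    have hh : ∀ i, h i = (s / 4) • a i + quatI * a i * imagQuaternion ((-1 / 4 : ℝ) • p) :=
      fun i => rfl
    have ha3 : ∑ i, ‖a i‖ ^ 2 = 2 := by rw [← norm_sq_eq_sum, ha1]
    have hinner : inner ℝ a h = s / 2 := by
      rw [PiLp.inner_apply]
      simp only [hh, inner_smul_add_quatI_mul]
      rw [Finset.sum_sub_distrib, ← sum_inner, ha2, inner_zero_left, ← Finset.mul_sum, ha3]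
      ring
    refine ⟨h, (‖h‖ ^ 2, ∑ i, hopf (h i)), fun t => ?_⟩
    refine Prod.ext ?_ ?_
    · simp only [Prod.fst_add, Prod.smul_fst, smul_eq_mul]
      rw [norm_add_sq_real, inner_smul_right, hinner, norm_smul, mul_pow, Real.norm_eq_abs, sq_abs]
      ring
    · simp only [Prod.snd_add, Prod.smul_snd, PiLp.add_apply, PiLp.smul_apply]
      simp only [hh, hopf_add_smul]
      rw [Finset.sum_add_distrib, Finset.sum_add_distrib, ← Finset.smul_sum, ← Finset.smul_sum,
        Finset.sum_sub_distrib, ← Finset.smul_sum, ← Finset.sum_smul, ← Finset.mul_sum, ha2, ha3]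
      module
  · rw [finrank_piLp_two, Quaternion.finrank_eq_four, Module.finrank_prod,
      finrank_euclideanSpace, Module.finrank_self, Fintype.card_fin]
    omega

/-! ### Isometries of `ℍⁿ` -/

section Isometries

variable {n : ℕ}

/-- Permutation of the coordinates of `ℍⁿ`. -/
def permIsometry (σ : Equiv.Perm (Fin n)) : QuaternionSpace n →ₗᵢ[ℝ] QuaternionSpace n where
  toFun q := WithLp.toLp 2 fun i => q (σ i)
  map_add' x y := by
    ext i <;> simp
  map_smul' c x := by
    ext i <;> simp
  norm_map' q := by
    rw [← pow_left_inj₀ (norm_nonneg _) (norm_nonneg _) two_ne_zero, norm_sq_eq_sum,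
      norm_sq_eq_sum]
    exact Equiv.sum_comp σ fun i => ‖q i‖ ^ 2

/-- Left multiplication of one coordinate of `ℍⁿ` by a unit quaternion. -/
def mulIsometry (a : Fin n) (u : Quaternion ℝ) (hu : ‖u‖ = 1) :
    QuaternionSpace n →ₗᵢ[ℝ] QuaternionSpace n where
  toFun q := WithLp.toLp 2 fun i => if i = a then u * q i else q i
  map_add' x y := by
    refine PiLp.ext fun i => ?_
    simp only [PiLp.add_apply]
    split_ifs
    · exact mul_add _ _ _
    · rfl
  map_smul' c x := by
    refine PiLp.ext fun i => ?_
    simp only [PiLp.smul_apply, RingHom.id_apply]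
    split_ifs
    · exact mul_smul_comm _ _ _
    · rfl
  norm_map' q := by
    rw [← pow_left_inj₀ (norm_nonneg _) (norm_nonneg _) two_ne_zero, norm_sq_eq_sum,
      norm_sq_eq_sum]
    refine Finset.sum_congr rfl fun i _ => ?_
    change ‖if i = a then u * q i else q i‖ ^ 2 = ‖q i‖ ^ 2
    split_ifs
    · rw [norm_mul, hu, one_mul]
    · rfl

theorem mulIsometry_apply (a : Fin n) (u : Quaternion ℝ) (hu : ‖u‖ = 1) (q : QuaternionSpace n)
    (i : Fin n) : mulIsometry a u hu q i = if i = a then u * q i else q i := rfl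

/-- The coordinates `(x, y)` at `a, b` are replaced by `((x + y) / √2, (x - y) / √2)`. -/
def hadamardFun (a b : Fin n) (q : QuaternionSpace n) : QuaternionSpace n :=
  WithLp.toLp 2 fun i =>
    if i = a then (Real.sqrt 2)⁻¹ • (q a + q b)
    else if i = b then (Real.sqrt 2)⁻¹ • (q a - q b) else q i

theorem hadamardFun_apply_left (a b : Fin n) (q : QuaternionSpace n) :
    hadamardFun a b q a = (Real.sqrt 2)⁻¹ • (q a + q b) := if_pos rfl

theorem hadamardFun_apply_right {a b : Fin n} (hab : a ≠ b) (q : QuaternionSpace n) :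
    hadamardFun a b q b = (Real.sqrt 2)⁻¹ • (q a - q b) := by
  simp [hadamardFun, hab.symm]

theorem hadamardFun_apply_of_ne {a b i : Fin n} (ha : i ≠ a) (hb : i ≠ b)
    (q : QuaternionSpace n) : hadamardFun a b q i = q i := by
  simp [hadamardFun, ha, hb]

theorem inv_sqrt_two_sq : (Real.sqrt 2)⁻¹ ^ 2 = 1 / 2 := by
  rw [inv_pow, Real.sq_sqrt zero_le_two, one_div]

/-- The hypothesis on `φ` is the parallelogram law, valid for homogeneous quadratic maps. It applies
both to ‖·‖² and to `hopf`, so the rotation respects length and closure. -/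
theorem sum_hadamardFun {V : Type*} [AddCommGroup V] (φ : Quaternion ℝ → V)
    (hφ : ∀ x y, φ ((Real.sqrt 2)⁻¹ • (x + y)) + φ ((Real.sqrt 2)⁻¹ • (x - y)) = φ x + φ y)
    {a b : Fin n} (hab : a ≠ b) (q : QuaternionSpace n) :
    ∑ i, φ (hadamardFun a b q i) = ∑ i, φ (q i) := by
  rw [← sub_eq_zero, ← Finset.sum_sub_distrib, Fintype.sum_eq_add a b hab]
  · rw [hadamardFun_apply_left, hadamardFun_apply_right hab]
    have h := hφ (q a) (q b)
    rw [sub_add_sub_comm, h, sub_self]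
  · rintro i ⟨h1, h2⟩
    rw [hadamardFun_apply_of_ne h1 h2, sub_self]

theorem norm_sq_hadamard (x y : Quaternion ℝ) :
    ‖(Real.sqrt 2)⁻¹ • (x + y)‖ ^ 2 + ‖(Real.sqrt 2)⁻¹ • (x - y)‖ ^ 2 = ‖x‖ ^ 2 + ‖y‖ ^ 2 := by
  rw [norm_smul, norm_smul, mul_pow, mul_pow, Real.norm_eq_abs, sq_abs, inv_sqrt_two_sq,
    norm_add_sq_real, norm_sub_sq_real]
  ring

/-- A quartic form is not preserved; the defect is what ties the fourth moment to the mixed moments.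
-/
theorem norm_pow_four_hadamard (x y : Quaternion ℝ) :
    ‖(Real.sqrt 2)⁻¹ • (x + y)‖ ^ 4 + ‖(Real.sqrt 2)⁻¹ • (x - y)‖ ^ 4 =
      1 / 2 * (‖x‖ ^ 4 + ‖y‖ ^ 4) + (‖x‖ ^ 2 * ‖y‖ ^ 2 + 2 * inner ℝ x y ^ 2) := by
  have h : ∀ z : Quaternion ℝ, ‖(Real.sqrt 2)⁻¹ • z‖ ^ 4 = (1 / 2 * ‖z‖ ^ 2) ^ 2 := by
    intro z
    rw [norm_smul, Real.norm_eq_abs, ← inv_sqrt_two_sq, ← sq_abs (Real.sqrt 2)⁻¹]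
    ring
  rw [h, h, norm_add_sq_real, norm_sub_sq_real]
  ring

theorem hopf_smul (c : ℝ) (x : Quaternion ℝ) : hopf (c • x) = c ^ 2 • hopf x := by
  ext k
  fin_cases k
  · simp [hopf_apply_zero]; ring
  · simp [hopf_apply_one]; ring
  · simp [hopf_apply_two]; ring

theorem hopf_hadamard (x y : Quaternion ℝ) :
    hopf ((Real.sqrt 2)⁻¹ • (x + y)) + hopf ((Real.sqrt 2)⁻¹ • (x - y)) = hopf x + hopf y := by
  rw [hopf_smul, hopf_smul, inv_sqrt_two_sq]
  ext k
  fin_cases k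
  · simp [hopf_apply_zero]; ring
  · simp [hopf_apply_one]; ring
  · simp [hopf_apply_two]; ring

/-- `hadamardFun` as a linear isometry. -/
def hadamardIsometry {a b : Fin n} (hab : a ≠ b) : QuaternionSpace n →ₗᵢ[ℝ] QuaternionSpace n where
  toFun := hadamardFun a b
  map_add' x y := by
    refine PiLp.ext fun i => ?_
    simp only [hadamardFun, PiLp.add_apply]
    split_ifs
    · module
    · module
    · rfl
  map_smul' c x := by
    refine PiLp.ext fun i => ?_
    simp only [hadamardFun, PiLp.smul_apply, RingHom.id_apply]
    split_ifs
    · module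
    · module
    · rfl
  norm_map' q := by
    rw [← pow_left_inj₀ (norm_nonneg _) (norm_nonneg _) two_ne_zero, norm_sq_eq_sum,
      norm_sq_eq_sum]
    exact sum_hadamardFun (fun x => ‖x‖ ^ 2) norm_sq_hadamard hab q

theorem hadamardIsometry_apply {a b : Fin n} (hab : a ≠ b) (q : QuaternionSpace n) :
    hadamardIsometry hab q = hadamardFun a b q := rfl

theorem hadamardFun_hadamardFun {a b : Fin n} (hab : a ≠ b) (q : QuaternionSpace n) :
    hadamardFun a b (hadamardFun a b q) = q := by
  refine PiLp.ext fun i => ?_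
  have h := inv_sqrt_two_sq
  rw [sq] at h
  by_cases h1 : i = a
  · rw [h1, hadamardFun_apply_left, hadamardFun_apply_left, hadamardFun_apply_right hab,
      ← smul_add, smul_smul, h]
    module
  · by_cases h2 : i = b
    · rw [h2, hadamardFun_apply_right hab, hadamardFun_apply_left, hadamardFun_apply_right hab,
        ← smul_sub, smul_smul, h]
      module
    · rw [hadamardFun_apply_of_ne h1 h2, hadamardFun_apply_of_ne h1 h2]

theorem isPlanar_permIsometry (σ : Equiv.Perm (Fin n)) (q : QuaternionSpace n) :
    IsPlanar (permIsometry σ q) ↔ IsPlanar q :=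
  or_congr (σ.forall_congr_right (q := fun i => (q i).imI = 0 ∧ (q i).imK = 0))
    (σ.forall_congr_right (q := fun i => (q i).re = 0 ∧ (q i).imJ = 0))

theorem isPlanar_hadamardFun {a b : Fin n} (hab : a ≠ b) (q : QuaternionSpace n) :
    IsPlanar (hadamardFun a b q) ↔ IsPlanar q := by
  have key : ∀ q : QuaternionSpace n, IsPlanar q → IsPlanar (hadamardFun a b q) := by
    rintro q (h | h)
    · refine Or.inl fun i => ?_
      simp only [hadamardFun]
      split_ifs <;> simp [h]
    · refine Or.inr fun i => ?_
      simp only [hadamardFun]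
      split_ifs <;> simp [h]
  refine ⟨fun h => ?_, key q⟩
  have h2 := key _ h
  rwa [hadamardFun_hadamardFun hab] at h2

/-- Left multiplication by 𝐣 maps each of the planes 1 ⊕ 𝐣 and 𝐢 ⊕ 𝐤 to itself. Left multiplication
by 𝐢 exchanges them, which is why the phase argument is confined to the space models. -/
theorem isPlanar_mulIsometry_quatJ (a : Fin n) (q : QuaternionSpace n) :
    IsPlanar (mulIsometry a quatJ norm_quatJ q) ↔ IsPlanar q := by
  refine or_congr (forall_congr' fun i => ?_) (forall_congr' fun i => ?_)
  · rw [mulIsometry_apply]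
    split_ifs <;> simp [and_comm]
  · rw [mulIsometry_apply]
    split_ifs <;> simp [and_comm]

end Isometries

/-! ### Moments of symmetric models -/

/-- A compact subset of the sphere of radius `√2` in `ℍⁿ` of finite positive `d`-dimensional
volume, invariant under permutations of the coordinates and the Hadamard rotations in two
coordinates. -/
structure IsSymmetricModel {n : ℕ} (d : ℝ) (M : Set (QuaternionSpace n)) : Prop where
  isCompact : IsCompact M
  volume_ne_zero : Measure.hausdorffMeasure d M ≠ 0
  volume_lt_top : Measure.hausdorffMeasure d M < ∞
  norm_sq : ∀ q ∈ M, ‖q‖ ^ 2 = 2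
  perm : ∀ (σ : Equiv.Perm (Fin n)) (q : QuaternionSpace n), permIsometry σ q ∈ M ↔ q ∈ M
  hadamard : ∀ {a b : Fin n} (hab : a ≠ b) (q : QuaternionSpace n),
    hadamardIsometry hab q ∈ M ↔ q ∈ M

/-- Hausdorff measure is invariant under surjective isometries, and a linear isometry of a
finite-dimensional space into itself is surjective. -/
theorem integral_comp_isometry {n : ℕ} {d : ℝ} {M : Set (QuaternionSpace n)}
    (hM : MeasurableSet M) (g : QuaternionSpace n →ₗᵢ[ℝ] QuaternionSpace n)
    (hg : ∀ q, g q ∈ M ↔ q ∈ M) (F : QuaternionSpace n → ℝ) :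
    ∫ q, F (g q) ∂normalizedVolume d M = ∫ q, F q ∂normalizedVolume d M := by
  let e := g.toLinearIsometryEquiv rfl
  have he : ∀ q, e q = g q := fun q => rfl
  have hpre : e.toIsometryEquiv ⁻¹' M = M := Set.ext hg
  have h1 := (e.toIsometryEquiv.measurePreserving_hausdorffMeasure d).restrict_preimage hM
  rw [hpre] at h1
  have h2 := h1.integral_comp e.toHomeomorph.measurableEmbedding F
  rw [normalizedVolume, ProbabilityTheory.cond, integral_smul_measure, integral_smul_measure]
  exact congrArg _ h2

namespace IsSymmetricModel

variable {n : ℕ} {d : ℝ} {M : Set (QuaternionSpace n)}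

theorem isProbabilityMeasure (h : IsSymmetricModel d M) :
    IsProbabilityMeasure (normalizedVolume d M) :=
  ProbabilityTheory.cond_isProbabilityMeasure_of_finite h.volume_ne_zero h.volume_lt_top.ne

theorem ae_mem (h : IsSymmetricModel d M) : ∀ᵐ q ∂normalizedVolume d M, q ∈ M :=
  (ae_restrict_mem h.isCompact.measurableSet).filter_mono
    (Measure.AbsolutelyContinuous.ae_le Measure.smul_absolutelyContinuous)

theorem integrable (h : IsSymmetricModel d M) {F : QuaternionSpace n → ℝ} (hF : Continuous F) :
    Integrable F (normalizedVolume d M) := by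
  have := h.isProbabilityMeasure
  obtain ⟨C, hC⟩ := h.isCompact.exists_bound_of_continuousOn hF.continuousOn
  exact Integrable.of_bound hF.aestronglyMeasurable C (h.ae_mem.mono hC)

theorem integral_perm (h : IsSymmetricModel d M) (σ : Equiv.Perm (Fin n))
    (F : Quaternion ℝ → Quaternion ℝ → ℝ) (a b : Fin n) :
    ∫ q, F (q (σ a)) (q (σ b)) ∂normalizedVolume d M = ∫ q, F (q a) (q b) ∂normalizedVolume d M :=
  integral_comp_isometry h.isCompact.measurableSet (permIsometry σ) (h.perm σ)
    (fun q => F (q a) (q b))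

theorem integral_pair_eq (h : IsSymmetricModel d M) (F : Quaternion ℝ → Quaternion ℝ → ℝ)
    {a b a' b' : Fin n} (hab : a ≠ b) (hab' : a' ≠ b') :
    ∫ q, F (q a) (q b) ∂normalizedVolume d M = ∫ q, F (q a') (q b') ∂normalizedVolume d M := by
  have h1 : Equiv.swap a a' b ≠ a' := fun hc =>
    hab ((Equiv.swap a a').injective (hc.trans (Equiv.swap_apply_left a a').symm)).symm
  -- The first swap takes a to a'; the second moves the image of b to b' and fixes a', which differs
  -- from both.
  have hσ := h.integral_perm (Equiv.swap (Equiv.swap a a' b) b' * Equiv.swap a a') F a b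
  rw [Equiv.Perm.mul_apply, Equiv.Perm.mul_apply, Equiv.swap_apply_left, Equiv.swap_apply_left,
    Equiv.swap_apply_of_ne_of_ne h1.symm hab'] at hσ
  exact hσ.symm

theorem integral_norm_pow_four_eq (h : IsSymmetricModel d M) (a b : Fin n) :
    ∫ q, ‖q a‖ ^ 4 ∂normalizedVolume d M = ∫ q, ‖q b‖ ^ 4 ∂normalizedVolume d M := by
  have h1 := h.integral_perm (Equiv.swap a b) (fun x _ => ‖x‖ ^ 4) a a
  rw [Equiv.swap_apply_left] at h1
  exact h1.symm

/-- Invariance of E(‖q_a‖⁴ + ‖q_b‖⁴) under the Hadamard rotation reads 2A = A + C + 2D. -/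
theorem integral_norm_pow_four (h : IsSymmetricModel d M) {a b : Fin n} (hab : a ≠ b) :
    ∫ q, ‖q a‖ ^ 4 ∂normalizedVolume d M =
      ∫ q, ‖q a‖ ^ 2 * ‖q b‖ ^ 2 ∂normalizedVolume d M +
        2 * ∫ q, (inner ℝ (q a) (q b)) ^ 2 ∂normalizedVolume d M := by
  have ca := continuous_eval (n := n) a
  have cb := continuous_eval (n := n) b
  have h1 := integral_comp_isometry (d := d) h.isCompact.measurableSet (hadamardIsometry hab)
    (h.hadamard hab) (fun q => ‖q a‖ ^ 4 + ‖q b‖ ^ 4)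
  simp only [hadamardIsometry_apply, hadamardFun_apply_left, hadamardFun_apply_right hab,
    norm_pow_four_hadamard] at h1
  rw [integral_add (h.integrable (by fun_prop)) (h.integrable (by fun_prop)),
    integral_add (h.integrable (by fun_prop)) (h.integrable (by fun_prop)), integral_const_mul,
    integral_const_mul,
    integral_add (h.integrable (by fun_prop)) (h.integrable (by fun_prop)),
    ← h.integral_norm_pow_four_eq a b] at h1
  linarith

theorem integral_inner_hopf (h : IsSymmetricModel d M) (a b : Fin n) :
    ∫ q, inner ℝ (hopf (q a)) (hopf (q b)) ∂normalizedVolume d M =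
      2 * (∫ q, (inner ℝ (q a) (q b)) ^ 2 ∂normalizedVolume d M +
        ∫ q, (inner ℝ (quatI * q a) (q b)) ^ 2 ∂normalizedVolume d M) -
      ∫ q, ‖q a‖ ^ 2 * ‖q b‖ ^ 2 ∂normalizedVolume d M := by
  have ca := continuous_eval (n := n) a
  have cb := continuous_eval (n := n) b
  simp only [inner_hopf]
  rw [integral_sub (h.integrable (by fun_prop)) (h.integrable (by fun_prop)), integral_const_mul,
    integral_add (h.integrable (by fun_prop)) (h.integrable (by fun_prop))]

/-- This is the expectation of (Σ ‖q_i‖²)² = 2². -/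
theorem sum_integral_norm_sq_mul (h : IsSymmetricModel d M) :
    ∑ i, ∑ j, ∫ q, ‖q i‖ ^ 2 * ‖q j‖ ^ 2 ∂normalizedVolume d M = 4 := by
  have := h.isProbabilityMeasure
  have c := continuous_eval (n := n)
  have h1 : ∫ q, ∑ i, ∑ j, ‖q i‖ ^ 2 * ‖q j‖ ^ 2 ∂normalizedVolume d M = 4 := by
    have h2 : ∀ᵐ q ∂normalizedVolume d M, ∑ i, ∑ j, ‖q i‖ ^ 2 * ‖q j‖ ^ 2 = 4 := by
      filter_upwards [h.ae_mem] with q hq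
      rw [← Finset.sum_mul_sum, ← norm_sq_eq_sum, h.norm_sq q hq]
      norm_num
    rw [integral_congr_ae h2]
    simp
  rw [← h1, integral_finsetSum _ fun i _ => h.integrable (by fun_prop)]
  refine Finset.sum_congr rfl fun i _ => ?_
  rw [integral_finsetSum _ fun j _ => h.integrable (by fun_prop)]

theorem integral_norm_sq_mul_self (a : Fin n) :
    ∫ q, ‖q a‖ ^ 2 * ‖q a‖ ^ 2 ∂normalizedVolume d M =
      ∫ q, ‖q a‖ ^ 4 ∂normalizedVolume d M :=
  integral_congr_ae (Eventually.of_forall fun q => by ring)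

theorem sum_sum_ite_eq (n : ℕ) (A C : ℝ) :
    ∑ i : Fin n, ∑ j : Fin n, (if i = j then A else C) = n * A + n * (n - 1) * C := by
  have h : ∀ i j : Fin n, (if i = j then A else C) = (if i = j then A - C else 0) + C := by
    intro i j
    split_ifs <;> ring
  simp only [h, Finset.sum_add_distrib, Finset.sum_ite_eq, Finset.mem_univ, if_true,
    Finset.sum_const, Finset.card_univ, Fintype.card_fin, nsmul_eq_mul]
  ring

/-- The fourth moment is determined by the mixed moments. -/
theorem fourth_moment_eq (h : IsSymmetricModel d M) {a : Fin n} {C : ℝ}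
    (hC : ∀ i j : Fin n, i ≠ j → ∫ q, ‖q i‖ ^ 2 * ‖q j‖ ^ 2 ∂normalizedVolume d M = C) :
    n * ∫ q, ‖q a‖ ^ 4 ∂normalizedVolume d M + n * (n - 1) * C = 4 := by
  rw [← h.sum_integral_norm_sq_mul, ← sum_sum_ite_eq]
  refine Finset.sum_congr rfl fun i _ => Finset.sum_congr rfl fun j _ => ?_
  split_ifs with hij
  · rw [← hij, integral_norm_sq_mul_self, h.integral_norm_pow_four_eq a i]
  · exact (hC i j hij).symm

theorem integral_inner_hopf_eq_ite (h : IsSymmetricModel d M) (a : Fin n) {B : ℝ}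
    (hB : ∀ i j : Fin n, i ≠ j →
      ∫ q, inner ℝ (hopf (q i)) (hopf (q j)) ∂normalizedVolume d M = B) (i j : Fin n) :
    ∫ q, inner ℝ (hopf (q i)) (hopf (q j)) ∂normalizedVolume d M =
      if i = j then ∫ q, ‖q a‖ ^ 4 ∂normalizedVolume d M else B := by
  split_ifs with hij
  · rw [← hij, h.integral_norm_pow_four_eq a i]
    simp only [inner_hopf_self]
  · exact hB i j hij

/-- Expand the expectation of |Σ hopf(q_i)|², which vanishes on `M`. -/
theorem integral_inner_hopf_of_closed (h : IsSymmetricModel d M) {a : Fin n} {B : ℝ}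
    (hB : ∀ i j : Fin n, i ≠ j →
      ∫ q, inner ℝ (hopf (q i)) (hopf (q j)) ∂normalizedVolume d M = B)
    (hclosed : ∀ q ∈ M, ∑ i, hopf (q i) = 0) :
    n * ∫ q, ‖q a‖ ^ 4 ∂normalizedVolume d M + n * (n - 1) * B = 0 := by
  have c : ∀ i : Fin n, Continuous fun q : QuaternionSpace n => hopf (q i) :=
    fun i => continuous_hopf.comp (continuous_eval i)
  have h1 : ∫ q, ∑ i, ∑ j, inner ℝ (hopf (q i)) (hopf (q j)) ∂normalizedVolume d M = 0 := by
    have h2 : ∀ᵐ q ∂normalizedVolume d M,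
        ∑ i, ∑ j, inner ℝ (hopf (q i)) (hopf (q j)) = 0 := by
      filter_upwards [h.ae_mem] with q hq
      simp only [← inner_sum, hclosed q hq, inner_zero_right, Finset.sum_const_zero]
    rw [integral_congr_ae h2]
    simp
  rw [← h1, ← sum_sum_ite_eq, integral_finsetSum _ fun i _ => h.integrable (by fun_prop)]
  refine Finset.sum_congr rfl fun i _ => ?_
  rw [integral_finsetSum _ fun j _ => h.integrable (by fun_prop)]
  exact Finset.sum_congr rfl fun j _ => (h.integral_inner_hopf_eq_ite a hB i j).symm

theorem integral_inner_hopf_of_quatJ (h : IsSymmetricModel d M)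
    (hJ : ∀ a q, mulIsometry a quatJ norm_quatJ q ∈ M ↔ q ∈ M) {a b : Fin n} (hab : a ≠ b) :
    ∫ q, inner ℝ (hopf (q a)) (hopf (q b)) ∂normalizedVolume d M = 0 := by
  have h1 := integral_comp_isometry (d := d) h.isCompact.measurableSet
    (mulIsometry a quatJ norm_quatJ) (hJ a) (fun q => inner ℝ (hopf (q a)) (hopf (q b)))
  simp only [mulIsometry_apply, if_true, if_neg hab.symm, hopf_quatJ_mul, inner_neg_left] at h1
  rw [integral_neg] at h1
  linarith

theorem integral_inner_quatI_mul_of_quatI (h : IsSymmetricModel d M)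
    (hI : ∀ a q, mulIsometry a quatI norm_quatI q ∈ M ↔ q ∈ M) {a b : Fin n} (hab : a ≠ b) :
    ∫ q, (inner ℝ (quatI * q a) (q b)) ^ 2 ∂normalizedVolume d M =
      ∫ q, (inner ℝ (q a) (q b)) ^ 2 ∂normalizedVolume d M := by
  have h1 := integral_comp_isometry (d := d) h.isCompact.measurableSet
    (mulIsometry a quatI norm_quatI) (hI a) (fun q => (inner ℝ (q a) (q b)) ^ 2)
  simpa only [mulIsometry_apply, if_true, if_neg hab.symm] using h1

/-- Multiplication by 𝐢 carries q_a into the plane orthogonal to the one containing q_b. -/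
theorem integral_inner_quatI_mul_of_isPlanar (h : IsSymmetricModel d M)
    (hP : ∀ q ∈ M, IsPlanar q) (a b : Fin n) :
    ∫ q, (inner ℝ (quatI * q a) (q b)) ^ 2 ∂normalizedVolume d M = 0 := by
  have h2 : ∀ᵐ q ∂normalizedVolume d M, (inner ℝ (quatI * q a) (q b)) ^ 2 = (0 : ℝ) := by
    filter_upwards [h.ae_mem] with q hq
    rw [quaternion_inner]
    rcases hP q hq with h | h <;> simp [h]
  rw [integral_congr_ae h2]
  simp

end IsSymmetricModel

/-! ### The radius of gyration in terms of edge correlations -/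

section Gyradius

variable {n : ℕ}

theorem sum_ite_lt {k : ℕ} (hk : k ≤ n) :
    ∑ l : Fin n, (if (l : ℕ) < k then (1 : ℝ) else 0) = k := by
  rw [Fin.sum_univ_eq_sum_range (fun l => if l < k then (1 : ℝ) else 0) n, Finset.sum_boole]
  have h : (Finset.range n).filter (fun l => l < k) = Finset.range k := by
    ext l
    simp only [Finset.mem_filter, Finset.mem_range]
    omega
  rw [h, Finset.card_range]

/-- The coefficient of the edge `l` in the difference of the vertices `i` and `j`. -/
def edgeCoeff (i j l : ℕ) : ℝ := (if l < i then 1 else 0) - (if l < j then 1 else 0)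

theorem sum_edgeCoeff {i j : ℕ} (hi : i ≤ n) (hj : j ≤ n) :
    ∑ l : Fin n, edgeCoeff i j l = (i : ℝ) - j := by
  simp only [edgeCoeff, Finset.sum_sub_distrib]
  rw [sum_ite_lt hi, sum_ite_lt hj]

/-- The coefficients are 0 or ±1, nonzero exactly on the edges between the two vertices. -/
theorem sum_edgeCoeff_sq {i j : ℕ} (hi : i ≤ n) (hj : j ≤ n) :
    ∑ l : Fin n, edgeCoeff i j l ^ 2 = |(i : ℝ) - j| := by
  rcases le_total i j with h | h
  · have h1 : ∀ l : ℕ, edgeCoeff i j l ^ 2 =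
        (if l < j then 1 else 0) - (if l < i then 1 else 0) := by
      intro l
      simp only [edgeCoeff]
      split_ifs <;> first | omega | norm_num
    simp only [h1, Finset.sum_sub_distrib]
    rw [sum_ite_lt hi, sum_ite_lt hj, abs_of_nonpos (by simpa using h), neg_sub]
  · have h1 : ∀ l : ℕ, edgeCoeff i j l ^ 2 =
        (if l < i then 1 else 0) - (if l < j then 1 else 0) := by
      intro l
      simp only [edgeCoeff]
      split_ifs <;> first | omega | norm_num
    simp only [h1, Finset.sum_sub_distrib]
    rw [sum_ite_lt hi, sum_ite_lt hj, abs_of_nonneg (by simpa using h)]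

theorem vertex_sub_vertex (e : EdgeList n) (i j : ℕ) :
    vertex e i - vertex e j = ∑ l : Fin n, edgeCoeff i j l • e l := by
  simp only [vertex, Finset.sum_filter, ← Finset.sum_sub_distrib, edgeCoeff, sub_smul, ite_smul,
    one_smul, zero_smul]

theorem norm_sq_vertex_sub (e : EdgeList n) (i j : ℕ) :
    ‖vertex e i - vertex e j‖ ^ 2 =
      ∑ l : Fin n, ∑ k : Fin n, edgeCoeff i j l * edgeCoeff i j k * inner ℝ (e l) (e k) := by
  rw [vertex_sub_vertex, ← real_inner_self_eq_norm_sq, sum_inner]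
  refine Finset.sum_congr rfl fun l _ => ?_
  rw [inner_sum]
  refine Finset.sum_congr rfl fun k _ => ?_
  rw [real_inner_smul_left, real_inner_smul_right, mul_assoc]

theorem sum_mul_ite (c : Fin n → ℝ) (A B : ℝ) :
    ∑ l, ∑ k, c l * c k * (if l = k then A else B) =
      (A - B) * ∑ l, c l ^ 2 + B * (∑ l, c l) ^ 2 := by
  have h : ∀ l k, c l * c k * (if l = k then A else B) =
      (if l = k then (A - B) * (c l * c k) else 0) + B * (c l * c k) := by
    intro l k
    split_ifs <;> ring
  simp only [h, Finset.sum_add_distrib, Finset.sum_ite_eq, Finset.mem_univ, if_true,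
    ← Finset.mul_sum, ← sq]
  rw [← Finset.sum_mul, sq (∑ l, c l)]

theorem continuous_vertex (k : ℕ) : Continuous fun e : EdgeList n => vertex e k :=
  continuous_finsetSum _ fun j _ => continuous_apply j

theorem continuous_vertexGyradius (m : ℕ) :
    Continuous fun e : EdgeList n => vertexGyradius fun k : Fin m => vertex e k := by
  have h := fun k => continuous_vertex (n := n) k
  unfold vertexGyradius
  fun_prop

/-! ### Sums of |i - j| and (i - j)² over pairs of indices -/

theorem sum_range_sub_left (m : ℕ) :
    ∑ i ∈ Finset.range m, ((m : ℝ) - i) = m * (m + 1) / 2 := by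
  rw [Finset.sum_sub_distrib, Finset.sum_const, Finset.card_range, nsmul_eq_mul]
  have h : ∑ i ∈ Finset.range m, (i : ℝ) = m * (m - 1) / 2 := by
    induction m with
    | zero => simp
    | succ m ih =>
      rw [Finset.sum_range_succ, ih]
      push_cast
      ring
  rw [h]
  ring

theorem sum_range_sub_left_sq (m : ℕ) :
    ∑ i ∈ Finset.range m, ((m : ℝ) - i) ^ 2 = m * (m + 1) * (2 * m + 1) / 6 := by
  rw [← Finset.sum_range_reflect]
  have h : ∀ j ∈ Finset.range m, ((m : ℝ) - ((m - 1 - j : ℕ) : ℝ)) ^ 2 = ((j : ℝ) + 1) ^ 2 := by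
    intro j hj
    rw [Finset.mem_range] at hj
    rw [Nat.cast_sub (by omega), Nat.cast_sub (by omega)]
    push_cast
    ring
  rw [Finset.sum_congr rfl h]
  clear h
  induction m with
  | zero => simp
  | succ m ih =>
    rw [Finset.sum_range_succ, ih]
    push_cast
    ring

theorem sum_sum_range_succ (f : ℕ → ℕ → ℝ) (hf : ∀ i j, f i j = f j i) (m : ℕ) :
    ∑ i ∈ Finset.range (m + 1), ∑ j ∈ Finset.range (m + 1), f i j =
      ∑ i ∈ Finset.range m, ∑ j ∈ Finset.range m, f i j + 2 * ∑ i ∈ Finset.range m, f i m +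
        f m m := by
  simp only [Finset.sum_range_succ, Finset.sum_add_distrib]
  rw [Finset.sum_congr rfl fun j _ => hf m j]
  ring

theorem sum_range_abs_sub (m : ℕ) :
    ∑ i ∈ Finset.range m, ∑ j ∈ Finset.range m, |(i : ℝ) - j| = m * (m ^ 2 - 1) / 3 := by
  induction m with
  | zero => simp
  | succ m ih =>
    rw [sum_sum_range_succ (fun i j => |(i : ℝ) - j|) (fun i j => abs_sub_comm _ _), ih]
    have h : ∀ i ∈ Finset.range m, |(i : ℝ) - m| = m - i := by
      intro i hi
      have h1 : (i : ℝ) ≤ m := by exact_mod_cast (Finset.mem_range.1 hi).le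
      rw [abs_of_nonpos (by linarith), neg_sub]
    rw [Finset.sum_congr rfl h, sum_range_sub_left, sub_self, abs_zero]
    push_cast
    ring

theorem sum_range_sub_sq (m : ℕ) :
    ∑ i ∈ Finset.range m, ∑ j ∈ Finset.range m, ((i : ℝ) - j) ^ 2 =
      m ^ 2 * (m ^ 2 - 1) / 6 := by
  induction m with
  | zero => simp
  | succ m ih =>
    rw [sum_sum_range_succ (fun i j => ((i : ℝ) - j) ^ 2) (fun i j => by ring), ih]
    have h : ∀ i ∈ Finset.range m, ((i : ℝ) - m) ^ 2 = (m - i) ^ 2 := fun i _ => by ring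
    rw [Finset.sum_congr rfl h, sum_range_sub_left_sq]
    push_cast
    ring

/-- Expected radius of gyration of the first `m` vertices of a random polygon whose edges `e i`
satisfy `E ⟪e i, e j⟫ = A` for `i = j` and `E ⟪e i, e j⟫ = B` otherwise. -/
theorem integral_vertexGyradius {Ω : Type*} [MeasurableSpace Ω] {ν : Measure Ω}
    {e : Ω → EdgeList n} {A B : ℝ} {m : ℕ} (hm0 : m ≠ 0) (hm : m ≤ n + 1)
    (hint : ∀ i j, Integrable (fun ω => inner ℝ (e ω i) (e ω j)) ν)
    (hAB : ∀ i j, ∫ ω, inner ℝ (e ω i) (e ω j) ∂ν = if i = j then A else B) :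
    ∫ ω, vertexGyradius (fun k : Fin m => vertex (e ω) k) ∂ν =
      ((m : ℝ) ^ 2 - 1) * (B / 12 + (A - B) / (6 * m)) := by
  have hmR : (m : ℝ) ≠ 0 := Nat.cast_ne_zero.2 hm0
  have hint2 : ∀ (i j : ℕ) (l k : Fin n), Integrable
      (fun ω => edgeCoeff i j l * edgeCoeff i j k * inner ℝ (e ω l) (e ω k)) ν :=
    fun i j l k => (hint l k).const_mul _
  -- Split the correlation matrix as (A - B) times the identity plus B times the all-ones matrix:
  -- the first sees the number of edges between the vertices, the second its square.
  have hdist : ∀ i j : Fin m, ∫ ω, ‖vertex (e ω) i - vertex (e ω) j‖ ^ 2 ∂ν =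
      (A - B) * |((i : ℕ) : ℝ) - (j : ℕ)| + B * (((i : ℕ) : ℝ) - (j : ℕ)) ^ 2 := by
    intro i j
    have hi : (i : ℕ) ≤ n := by omega
    have hj : (j : ℕ) ≤ n := by omega
    simp only [norm_sq_vertex_sub]
    rw [integral_finsetSum _ fun l _ => integrable_finsetSum _ fun k _ => hint2 i j l k]
    simp_rw [integral_finsetSum _ fun k _ => hint2 i j _ k, integral_const_mul, hAB]
    rw [sum_mul_ite, sum_edgeCoeff_sq hi hj, sum_edgeCoeff hi hj]
  have hdint : ∀ i j : Fin m,
      Integrable (fun ω => ‖vertex (e ω) i - vertex (e ω) j‖ ^ 2) ν := by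
    intro i j
    simp only [norm_sq_vertex_sub]
    exact integrable_finsetSum _ fun l _ => integrable_finsetSum _ fun k _ => hint2 i j l k
  simp only [vertexGyradius]
  rw [integral_const_mul,
    integral_finsetSum _ fun i _ => integrable_finsetSum _ fun j _ => hdint i j]
  simp_rw [integral_finsetSum _ fun j _ => hdint _ j, hdist]
  rw [Fin.sum_univ_eq_sum_range (fun i => ∑ j : Fin m,
    ((A - B) * |(i : ℝ) - (j : ℕ)| + B * ((i : ℝ) - (j : ℕ)) ^ 2)) m]
  have h : ∀ i : ℕ, ∑ j : Fin m, ((A - B) * |(i : ℝ) - (j : ℕ)| + B * ((i : ℝ) - (j : ℕ)) ^ 2) =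
      (A - B) * ∑ j ∈ Finset.range m, |(i : ℝ) - j| +
        B * ∑ j ∈ Finset.range m, ((i : ℝ) - j) ^ 2 := by
    intro i
    rw [Fin.sum_univ_eq_sum_range
      (fun j => (A - B) * |(i : ℝ) - j| + B * ((i : ℝ) - j) ^ 2) m,
      Finset.sum_add_distrib, Finset.mul_sum, Finset.mul_sum]
  simp only [h, Finset.sum_add_distrib, ← Finset.mul_sum]
  rw [sum_range_abs_sub, sum_range_sub_sq]
  field_simp
  ring

end Gyradius

/-! ### Expectations over the polygon spaces -/

section PolygonSpaces

variable {n : ℕ}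

theorem measurableSet_arm3 : MeasurableSet (Arm3 n) :=
  (isClosed_eq (by fun_prop) continuous_const).measurableSet

theorem measurableSet_arm2 : MeasurableSet (Arm2 n) := by
  have h : IsClosed {e : EdgeList n | ∀ i, e i 1 = 0} := by
    simp only [Set.ofPred_forall]
    exact isClosed_iInter fun i => isClosed_eq (by fun_prop) continuous_const
  exact measurableSet_arm3.inter h.measurableSet

theorem measurableSet_closed : MeasurableSet {e : EdgeList n | ∑ i, e i = 0} :=
  (isClosed_eq (by fun_prop) continuous_const).measurableSet

theorem measurableSet_pol3 : MeasurableSet (Pol3 n) :=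
  measurableSet_arm3.inter measurableSet_closed

theorem measurableSet_pol2 : MeasurableSet (Pol2 n) :=
  measurableSet_arm2.inter measurableSet_closed

theorem hopfMap_mem_arm3 {q : QuaternionSpace n} (hq : ‖q‖ ^ 2 = 2) : hopfMap q ∈ Arm3 n := by
  change ∑ i, ‖hopf (q i)‖ = 2
  simp only [norm_hopf]
  rw [← norm_sq_eq_sum, hq]

theorem hopf_apply_one_of_isPlanar {q : QuaternionSpace n} (hq : IsPlanar q) (i : Fin n) :
    hopf (q i) 1 = 0 := by
  rw [hopf_apply_one]
  rcases hq with h | h <;> simp [h]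

/-- Expectations for the push-forward of the volume of a model are expectations over the model. -/
theorem integral_pushHopf {d : ℝ} {M : Set (QuaternionSpace n)} {X : Set (EdgeList n)}
    (h : IsSymmetricModel d M) (hX : MeasurableSet X) (hMX : ∀ q ∈ M, hopfMap q ∈ X)
    {G : EdgeList n → ℝ} (hG : Continuous G) :
    ∫ P : X, G P.1 ∂pushHopf d M X = ∫ q, G (hopfMap q) ∂normalizedVolume d M := by
  have hae : ∀ᵐ e ∂(normalizedVolume d M).map hopfMap, e ∈ X :=
    (ae_map_iff continuous_hopfMap.aemeasurable hX).2 (h.ae_mem.mono hMX)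
  rw [pushHopf, integral_subtype_comap hX, Measure.restrict_eq_self_of_ae_mem hae,
    integral_map continuous_hopfMap.aemeasurable hG.aestronglyMeasurable]

/-- The bound on `m` covers both conventions: n + 1 vertices for arms and n for closed polygons. -/
theorem IsSymmetricModel.integral_gyradius {d : ℝ} {M : Set (QuaternionSpace n)}
    {X : Set (EdgeList n)} (h : IsSymmetricModel d M) (hX : MeasurableSet X)
    (hMX : ∀ q ∈ M, hopfMap q ∈ X) (a : Fin n) {B : ℝ}
    (hB : ∀ i j : Fin n, i ≠ j →
      ∫ q, inner ℝ (hopf (q i)) (hopf (q j)) ∂normalizedVolume d M = B)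
    {m : ℕ} (hm0 : m ≠ 0) (hm : m ≤ n + 1) :
    ∫ P : X, vertexGyradius (fun k : Fin m => vertex P.1 k) ∂pushHopf d M X =
      ((m : ℝ) ^ 2 - 1) *
        (B / 12 + (∫ q, ‖q a‖ ^ 4 ∂normalizedVolume d M - B) / (6 * m)) := by
  rw [integral_pushHopf h hX hMX (continuous_vertexGyradius m)]
  refine integral_vertexGyradius hm0 hm (fun i j => h.integrable ?_)
    (h.integral_inner_hopf_eq_ite a hB)
  exact (continuous_hopf.comp (continuous_eval i)).inner (continuous_hopf.comp (continuous_eval j))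

/-! ### Symmetry of the four models -/

theorem sum_hopf_permIsometry (σ : Equiv.Perm (Fin n)) (q : QuaternionSpace n) :
    ∑ i, hopf (permIsometry σ q i) = ∑ i, hopf (q i) :=
  Equiv.sum_comp σ fun i => hopf (q i)

theorem sum_hopf_mulIsometry_quatI (a : Fin n) (q : QuaternionSpace n) :
    ∑ i, hopf (mulIsometry a quatI norm_quatI q i) = ∑ i, hopf (q i) := by
  refine Finset.sum_congr rfl fun i _ => ?_
  rw [mulIsometry_apply]
  split_ifs
  · rw [hopf_quatI_mul]
  · rfl

theorem isSymmetricModel_arm3 (hn : 1 ≤ n) :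
    IsSymmetricModel (4 * (n : ℝ) - 1) (arm3Model n) where
  isCompact := isCompact_arm3Model n
  volume_ne_zero := (hausdorffMeasure_arm3Model hn).1
  volume_lt_top := (hausdorffMeasure_arm3Model hn).2
  norm_sq q hq := mem_arm3Model.1 hq
  perm σ q := by simp only [mem_arm3Model, LinearIsometry.norm_map]
  hadamard hab q := by simp only [mem_arm3Model, LinearIsometry.norm_map]

theorem isSymmetricModel_arm2 (hn : 1 ≤ n) :
    IsSymmetricModel (2 * (n : ℝ) - 1) (arm2Model n) where
  isCompact := isCompact_arm2Model n
  volume_ne_zero := (hausdorffMeasure_arm2Model hn).1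
  volume_lt_top := (hausdorffMeasure_arm2Model hn).2
  norm_sq q hq := (mem_arm2Model.1 hq).1
  perm σ q := by simp only [mem_arm2Model, LinearIsometry.norm_map, isPlanar_permIsometry]
  hadamard hab q := by
    rw [mem_arm2Model, mem_arm2Model, LinearIsometry.norm_map]
    simp only [hadamardIsometry_apply,
      isPlanar_hadamardFun hab]

theorem isSymmetricModel_pol3 (hn : 2 ≤ n) :
    IsSymmetricModel (4 * (n : ℝ) - 4) (pol3Model n) where
  isCompact := isCompact_pol3Model n
  volume_ne_zero := (hausdorffMeasure_pol3Model hn).1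
  volume_lt_top := (hausdorffMeasure_pol3Model hn).2
  norm_sq q hq := (mem_pol3Model.1 hq).1
  perm σ q := by simp only [mem_pol3Model, LinearIsometry.norm_map, sum_hopf_permIsometry]
  hadamard hab q := by
    rw [mem_pol3Model, mem_pol3Model, LinearIsometry.norm_map]
    simp only [hadamardIsometry_apply,
      sum_hadamardFun hopf hopf_hadamard hab]

theorem isSymmetricModel_pol2 (hn : 2 ≤ n) :
    IsSymmetricModel (2 * (n : ℝ) - 3) (pol2Model n) where
  isCompact := isCompact_pol2Model n
  volume_ne_zero := (hausdorffMeasure_pol2Model hn).1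
  volume_lt_top := (hausdorffMeasure_pol2Model hn).2
  norm_sq q hq := (mem_pol2Model.1 hq).1
  perm σ q := by
    simp only [mem_pol2Model, LinearIsometry.norm_map, sum_hopf_permIsometry,
      isPlanar_permIsometry]
  hadamard hab q := by
    rw [mem_pol2Model, mem_pol2Model, LinearIsometry.norm_map]
    simp only [hadamardIsometry_apply,
      sum_hadamardFun hopf hopf_hadamard hab, isPlanar_hadamardFun hab]

/-! ### The four expected values -/

theorem integral_armGyradius_arm3 (hn : 1 ≤ n) :
    ∫ P : Arm3 n, armGyradius P.1 ∂symArm3 n =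
      ((n : ℝ) + 2) / (((n : ℝ) + 1) * ((n : ℝ) + 1 / 2)) := by
  have h := isSymmetricModel_arm3 hn
  let a : Fin n := ⟨0, hn⟩
  have hB : ∀ i j : Fin n, i ≠ j → ∫ q, inner ℝ (hopf (q i)) (hopf (q j))
      ∂normalizedVolume (4 * (n : ℝ) - 1) (arm3Model n) = 0 := fun i j hij =>
    h.integral_inner_hopf_of_quatJ
      (fun a q => by simp only [mem_arm3Model, LinearIsometry.norm_map]) hij
  have hG := h.integral_gyradius measurableSet_arm3
    (fun q hq => hopfMap_mem_arm3 (h.norm_sq q hq)) a hB (Nat.succ_ne_zero n) le_rfl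
  have hC : ∀ i j : Fin n, i ≠ j → ∫ q, ‖q i‖ ^ 2 * ‖q j‖ ^ 2
      ∂normalizedVolume (4 * (n : ℝ) - 1) (arm3Model n) =
      2 / 3 * ∫ q, ‖q a‖ ^ 4 ∂normalizedVolume (4 * (n : ℝ) - 1) (arm3Model n) := by
    intro i j hij
    -- Here 0 = 4D - C and A = C + 2D, so C = 2A/3.
    have h1 := h.integral_norm_pow_four hij
    have h2 := h.integral_inner_hopf i j
    rw [hB i j hij, h.integral_inner_quatI_mul_of_quatI
      (fun a q => by simp only [mem_arm3Model, LinearIsometry.norm_map]) hij] at h2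
    rw [h.integral_norm_pow_four_eq a i]
    linarith
  have hA := h.fourth_moment_eq (a := a) hC
  change ∫ P : Arm3 n, vertexGyradius (fun k : Fin (n + 1) => vertex P.1 k)
    ∂pushHopf (4 * (n : ℝ) - 1) (arm3Model n) (Arm3 n) = _
  rw [hG]
  set A := ∫ q, ‖q a‖ ^ 4 ∂normalizedVolume (4 * (n : ℝ) - 1) (arm3Model n)
  have hnR : (0 : ℝ) < n := by exact_mod_cast hn
  have hA' : A = 12 / (n * (2 * n + 1)) := by
    rw [eq_div_iff (by positivity)]
    linarith
  rw [hA']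
  push_cast
  field_simp
  ring

theorem integral_armGyradius_arm2 (hn : 1 ≤ n) :
    ∫ P : Arm2 n, armGyradius P.1 ∂symArm2 n =
      4 / 3 * (((n : ℝ) + 2) / ((n : ℝ) + 1) ^ 2) := by
  have h := isSymmetricModel_arm2 hn
  let a : Fin n := ⟨0, hn⟩
  have hB : ∀ i j : Fin n, i ≠ j → ∫ q, inner ℝ (hopf (q i)) (hopf (q j))
      ∂normalizedVolume (2 * (n : ℝ) - 1) (arm2Model n) = 0 := fun i j hij =>
    h.integral_inner_hopf_of_quatJ
      (fun a q => by simp only [mem_arm2Model, LinearIsometry.norm_map,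
        isPlanar_mulIsometry_quatJ]) hij
  have hG := h.integral_gyradius measurableSet_arm2
    (fun q hq => ⟨hopfMap_mem_arm3 (h.norm_sq q hq),
      hopf_apply_one_of_isPlanar (mem_arm2Model.1 hq).2⟩) a hB (Nat.succ_ne_zero n) le_rfl
  have hC : ∀ i j : Fin n, i ≠ j → ∫ q, ‖q i‖ ^ 2 * ‖q j‖ ^ 2
      ∂normalizedVolume (2 * (n : ℝ) - 1) (arm2Model n) =
      1 / 2 * ∫ q, ‖q a‖ ^ 4 ∂normalizedVolume (2 * (n : ℝ) - 1) (arm2Model n) := by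
    intro i j hij
    -- Here 0 = 2D - C and A = C + 2D, so C = A/2.
    have h1 := h.integral_norm_pow_four hij
    have h2 := h.integral_inner_hopf i j
    rw [hB i j hij, h.integral_inner_quatI_mul_of_isPlanar
      (fun q hq => (mem_arm2Model.1 hq).2) i j] at h2
    rw [h.integral_norm_pow_four_eq a i]
    linarith
  have hA := h.fourth_moment_eq (a := a) hC
  change ∫ P : Arm2 n, vertexGyradius (fun k : Fin (n + 1) => vertex P.1 k)
    ∂pushHopf (2 * (n : ℝ) - 1) (arm2Model n) (Arm2 n) = _
  rw [hG]
  set A := ∫ q, ‖q a‖ ^ 4 ∂normalizedVolume (2 * (n : ℝ) - 1) (arm2Model n)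
  have hnR : (0 : ℝ) < n := by exact_mod_cast hn
  have hA' : A = 8 / (n * (n + 1)) := by
    rw [eq_div_iff (by positivity)]
    linarith
  rw [hA']
  push_cast
  field_simp
  ring

theorem integral_polGyradius_pol3 (hn : 2 ≤ n) :
    ∫ P : Pol3 n, polGyradius P.1 ∂symPol3 n = 1 / 2 * (1 / (n : ℝ)) := by
  have h := isSymmetricModel_pol3 hn
  let a : Fin n := ⟨0, by omega⟩
  let b : Fin n := ⟨1, by omega⟩
  have hab : a ≠ b := by simp [a, b]
  have hclosed : ∀ q ∈ pol3Model n, ∑ i, hopf (q i) = 0 := fun q hq => (mem_pol3Model.1 hq).2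
  have hB := fun (i j : Fin n) (hij : i ≠ j) =>
    h.integral_pair_eq (fun x y => inner ℝ (hopf x) (hopf y)) hij hab
  have hC := fun (i j : Fin n) (hij : i ≠ j) =>
    h.integral_pair_eq (fun x y => ‖x‖ ^ 2 * ‖y‖ ^ 2) hij hab
  have hG := h.integral_gyradius measurableSet_pol3
    (fun q hq => ⟨hopfMap_mem_arm3 (h.norm_sq q hq), hclosed q hq⟩) a hB (m := n) (by omega)
    (Nat.le_succ n)
  have hA := h.fourth_moment_eq (a := a) hC
  have hAB := h.integral_inner_hopf_of_closed (a := a) hB hclosed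
  have h1 := h.integral_norm_pow_four hab
  have h2 := h.integral_inner_hopf a b
  rw [h.integral_inner_quatI_mul_of_quatI (fun a q => by
    simp only [mem_pol3Model, LinearIsometry.norm_map, sum_hopf_mulIsometry_quatI]) hab] at h2
  change ∫ P : Pol3 n, vertexGyradius (fun k : Fin n => vertex P.1 k)
    ∂pushHopf (4 * (n : ℝ) - 4) (pol3Model n) (Pol3 n) = _
  rw [hG]
  set A := ∫ q, ‖q a‖ ^ 4 ∂normalizedVolume (4 * (n : ℝ) - 4) (pol3Model n)
  set B := ∫ q, inner ℝ (hopf (q a)) (hopf (q b)) ∂normalizedVolume (4 * (n : ℝ) - 4) (pol3Model n)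
  set C := ∫ q, ‖q a‖ ^ 2 * ‖q b‖ ^ 2 ∂normalizedVolume (4 * (n : ℝ) - 4) (pol3Model n)
  set D := ∫ q, (inner ℝ (q a) (q b)) ^ 2 ∂normalizedVolume (4 * (n : ℝ) - 4) (pol3Model n)
  have hnR : (2 : ℝ) ≤ n := by exact_mod_cast hn
  have hn0 : (0 : ℝ) < n := by linarith
  have hn1 : (n : ℝ) - 1 ≠ 0 := by linarith
  -- Eliminate D from B = 4D - C and A = C + 2D; the length and closure relations then determine A.
  have hBC : B = 2 * A - 3 * C := by linarith
  have hA' : A = 6 / (n * (n + 1)) := by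
    rw [eq_div_iff (by positivity)]
    rw [hBC] at hAB
    linarith
  have hB' : B = -A / (n - 1) := by
    rw [eq_div_iff hn1]
    have h3 : (n : ℝ) * (B * (n - 1) + A) = 0 := by linarith
    rcases mul_eq_zero.1 h3 with h4 | h4 <;> linarith
  rw [hB', hA']
  field_simp
  ring

theorem integral_polGyradius_pol2 (hn : 2 ≤ n) :
    ∫ P : Pol2 n, polGyradius P.1 ∂symPol2 n =
      2 / 3 * (((n : ℝ) + 1) / ((n : ℝ) * ((n : ℝ) + 2))) := by
  have h := isSymmetricModel_pol2 hn
  let a : Fin n := ⟨0, by omega⟩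
  let b : Fin n := ⟨1, by omega⟩
  have hab : a ≠ b := by simp [a, b]
  have hclosed : ∀ q ∈ pol2Model n, ∑ i, hopf (q i) = 0 := fun q hq => (mem_pol2Model.1 hq).2.1
  have hplanar : ∀ q ∈ pol2Model n, IsPlanar q := fun q hq => (mem_pol2Model.1 hq).2.2
  have hB := fun (i j : Fin n) (hij : i ≠ j) =>
    h.integral_pair_eq (fun x y => inner ℝ (hopf x) (hopf y)) hij hab
  have hC := fun (i j : Fin n) (hij : i ≠ j) =>
    h.integral_pair_eq (fun x y => ‖x‖ ^ 2 * ‖y‖ ^ 2) hij hab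
  have hG := h.integral_gyradius measurableSet_pol2
    (fun q hq => ⟨⟨hopfMap_mem_arm3 (h.norm_sq q hq), hopf_apply_one_of_isPlanar (hplanar q hq)⟩,
      hclosed q hq⟩) a hB (m := n) (by omega) (Nat.le_succ n)
  have hA := h.fourth_moment_eq (a := a) hC
  have hAB := h.integral_inner_hopf_of_closed (a := a) hB hclosed
  have h1 := h.integral_norm_pow_four hab
  have h2 := h.integral_inner_hopf a b
  rw [h.integral_inner_quatI_mul_of_isPlanar hplanar a b] at h2
  change ∫ P : Pol2 n, vertexGyradius (fun k : Fin n => vertex P.1 k)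
    ∂pushHopf (2 * (n : ℝ) - 3) (pol2Model n) (Pol2 n) = _
  rw [hG]
  set A := ∫ q, ‖q a‖ ^ 4 ∂normalizedVolume (2 * (n : ℝ) - 3) (pol2Model n)
  set B := ∫ q, inner ℝ (hopf (q a)) (hopf (q b)) ∂normalizedVolume (2 * (n : ℝ) - 3) (pol2Model n)
  set C := ∫ q, ‖q a‖ ^ 2 * ‖q b‖ ^ 2 ∂normalizedVolume (2 * (n : ℝ) - 3) (pol2Model n)
  set D := ∫ q, (inner ℝ (q a) (q b)) ^ 2 ∂normalizedVolume (2 * (n : ℝ) - 3) (pol2Model n)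
  have hnR : (2 : ℝ) ≤ n := by exact_mod_cast hn
  have hn0 : (0 : ℝ) < n := by linarith
  have hn1 : (n : ℝ) - 1 ≠ 0 := by linarith
  -- In the plane the 𝐢-term is absent, so B = 2D - C, again with A = C + 2D.
  have hBC : B = A - 2 * C := by linarith
  have hA' : A = 8 / (n * (n + 2)) := by
    rw [eq_div_iff (by positivity)]
    rw [hBC] at hAB
    linarith
  have hB' : B = -A / (n - 1) := by
    rw [eq_div_iff hn1]
    have h3 : (n : ℝ) * (B * (n - 1) + A) = 0 := by linarith
    rcases mul_eq_zero.1 h3 with h4 | h4 <;> linarith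
  rw [hB', hA']
  field_simp
  ring

end PolygonSpaces

end RandomPolygon

end

theorem proposition7p2 (n : ℕ) :
    (1 ≤ n →
      ∫ P : RandomPolygon.Arm3 n, RandomPolygon.armGyradius P.1 ∂(RandomPolygon.symArm3 n) =
          ((n : ℝ) + 2) / (((n : ℝ) + 1) * ((n : ℝ) + 1 / 2)) ∧
      ∫ P : RandomPolygon.Arm2 n, RandomPolygon.armGyradius P.1 ∂(RandomPolygon.symArm2 n) =
          4 / 3 * (((n : ℝ) + 2) / ((n : ℝ) + 1) ^ 2)) ∧
    (2 ≤ n →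
      ∫ P : RandomPolygon.Pol3 n, RandomPolygon.polGyradius P.1 ∂(RandomPolygon.symPol3 n) =
          1 / 2 * (1 / (n : ℝ)) ∧
      ∫ P : RandomPolygon.Pol2 n, RandomPolygon.polGyradius P.1 ∂(RandomPolygon.symPol2 n) =
          2 / 3 * (((n : ℝ) + 1) / ((n : ℝ) * ((n : ℝ) + 2)))) :=
  ⟨fun hn => ⟨RandomPolygon.integral_armGyradius_arm3 hn,
      RandomPolygon.integral_armGyradius_arm2 hn⟩,
    fun hn => ⟨RandomPolygon.integral_polGyradius_pol3 hn,
      RandomPolygon.integral_polGyradius_pol2 hn⟩⟩
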